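/- Let $\ell \ge 5$ be prime, let $K$ be a number field which is Galois over $\mathbb{Q}$, with a fixed embedding into $\mathbb{C}$, let $v$ be a prime of $K$ above $\ell$, and let $\mathcal{O}_v$ be the ring of $v$-integral elements of $K$. Write $q = e^{2\pi i z}$ and let $\eta(z)=q^{1/24}\prod_{n\ge1}(1-q^n)$ be the Dedekind eta function, with multiplier $\nu_\eta$ defined by $\eta(\gamma z)=\nu_\eta(\gamma)(cz+d)^{1/2}\eta(z)$ for $\gamma=\begin{pmatrix}a&b\\c&d\end{pmatrix}\in \mathrm{SL}_2(\mathbb{Z})$ (principal branch). For $k \in \frac12+\mathbb{Z}$ and a positive integer $s$, let $S_k(1,\nu_\eta^s)$ be the set of cusp forms $f$ on $\mathrm{SL}_2(\mathbb{Z})$ of weight $k$ and multiplier $\nu_\eta^s$, i.e. $f(\gamma z)=\nu_\eta(\gamma)^s(cz+d)^{k}f(z)$, whose Fourier expansion $\sum_{n\ge 1} b(n)q^{n/24}$ has all its coefficients in $\mathcal{O}_v$. Congruences modulo $v$ between series in $q^{1/24}$ are meant coefficientwise, and $\left(\sum_{n\ge 1} b(n)q^{n/24}\right)|U_\ell=\sum_{n\ge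 1} b(\ell n)q^{n/24}$. Let $\lambda \ge 0$ be an integer, let $r$ be a positive integer with $\gcd(r,6)=1$, and suppose that $g\in S_{\lambda+\frac12}(1,\nu_\eta^r)$ satisfies $$g\equiv\sum_{n=1}^\infty a(n)q^{\frac{\ell n}{24}}\not\equiv 0 \pmod v.$$ Then there exist an integer $\lambda'\ge 0$ with $\lambda'+\frac12\le\frac1\ell\left(\lambda+\frac12\right)$ and a form $f\in S_{\lambda'+\frac12}(1,\nu_\eta^{r\ell})$ such that $$f\equiv g|U_\ell\equiv\sum_{n=1}^\infty a(n)q^{\frac n{24}}\pmod v.$$ -/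

import Mathlib

open scoped MatrixGroups UpperHalfPlane Manifold PowerSeries NumberField

noncomputable section

namespace EtaForms

/-- The factor `c z + d` for `γ = (a b; c d)` in `SL₂(ℤ)`. -/
def autFactor (γ : SL(2, ℤ)) (z : ℍ) : ℂ := ((γ 1 0 : ℤ) : ℂ) * (z : ℂ) + ((γ 1 1 : ℤ) : ℂ)

/-- The multiplier `ν_η` of the Dedekind eta function: the number with
`η(γ z) = ν_η(γ) (c z + d)^{1/2} η(z)`, principal branch. The quotient does not depend on `z`
(this is `eta_smul_eq` below), so it is computed at `z = i`. -/
def etaMultiplier (γ : SL(2, ℤ)) : ℂ :=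
  ModularForm.eta ((γ • UpperHalfPlane.I : ℍ) : ℂ) /
    (autFactor γ UpperHalfPlane.I ^ (1 / 2 : ℂ) * ModularForm.eta (UpperHalfPlane.I : ℂ))

theorem autFactor_eq_denom (γ : SL(2, ℤ)) (z : ℍ) : autFactor γ z = UpperHalfPlane.denom γ z := by
  simp [autFactor, UpperHalfPlane.denom]

theorem autFactor_ne_zero (γ : SL(2, ℤ)) (z : ℍ) : autFactor γ z ≠ 0 := by
  rw [autFactor_eq_denom]; exact UpperHalfPlane.denom_ne_zero _ z

theorem continuous_autFactor_sqrt (γ : SL(2, ℤ)) :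
    Continuous fun z : ℍ ↦ autFactor γ z ^ (1 / 2 : ℂ) := by
  by_cases hc : γ 1 0 = 0
  · simp only [autFactor, hc]
    simpa using continuous_const
  · refine Continuous.cpow ?_ continuous_const fun z ↦ ?_
    · unfold autFactor
      fun_prop
    · refine Complex.mem_slitPlane_iff.2 (Or.inr ?_)
      simp [autFactor, hc, z.im_ne_zero]

theorem eta_ratio_pow (γ : SL(2, ℤ)) (z : ℍ) :
    (ModularForm.eta ((γ • z : ℍ) : ℂ) /
      (autFactor γ z ^ (1 / 2 : ℂ) * ModularForm.eta (z : ℂ))) ^ 24 = 1 := by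
  have h := congrFun (SlashInvariantForm.slash_action_generators_SL2Z
    ModularForm.discriminant_S_invariant ModularForm.discriminant_T_invariant γ) z
  rw [ModularForm.SL_slash_apply, ← autFactor_eq_denom] at h
  unfold ModularForm.discriminant at h
  have hj := autFactor_ne_zero γ z
  have hη : ModularForm.eta (z : ℂ) ≠ 0 := ModularForm.eta_ne_zero z.2
  have hs : (autFactor γ z ^ (1 / 2 : ℂ)) ^ 24 = autFactor γ z ^ 12 := by
    rw [← Complex.cpow_nat_mul, ← Complex.cpow_natCast]
    norm_num
  generalize ModularForm.eta ((γ • z : ℍ) : ℂ) = x at *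
  generalize ModularForm.eta (z : ℂ) = y at *
  generalize autFactor γ z = j at *
  have hz : j ^ (-12 : ℤ) = (j ^ 12)⁻¹ := by rw [zpow_neg]; rfl
  rw [hz] at h
  rw [div_pow, mul_pow, hs, div_eq_one_iff_eq (mul_ne_zero (pow_ne_zero _ hj) (pow_ne_zero _ hη)),
    ← h, mul_comm (x ^ 24), mul_inv_cancel_left₀ (pow_ne_zero _ hj)]

/-- The transformation law of `η`. -/
theorem eta_smul_eq (γ : SL(2, ℤ)) (z : ℍ) :
    ModularForm.eta ((γ • z : ℍ) : ℂ) =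
      etaMultiplier γ * autFactor γ z ^ (1 / 2 : ℂ) * ModularForm.eta (z : ℂ) := by
  have hη : ∀ w : ℍ, ModularForm.eta (w : ℂ) ≠ 0 := fun w ↦ ModularForm.eta_ne_zero w.2
  have hηc : Continuous fun w : ℍ ↦ ModularForm.eta (w : ℂ) :=
    continuous_iff_continuousAt.2 fun w ↦
      (ModularForm.differentiableAt_eta_of_mem_upperHalfPlaneSet w.2).continuousAt.comp
        UpperHalfPlane.continuous_coe.continuousAt
  have hs : ∀ w : ℍ, autFactor γ w ^ (1 / 2 : ℂ) ≠ 0 := fun w ↦ by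
    simp [Complex.cpow_eq_zero_iff, autFactor_ne_zero]
  have hR : Continuous fun w : ℍ ↦ ModularForm.eta ((γ • w : ℍ) : ℂ) /
      (autFactor γ w ^ (1 / 2 : ℂ) * ModularForm.eta (w : ℂ)) :=
    (hηc.comp (continuous_const_smul (γ : GL (Fin 2) ℝ))).div ((continuous_autFactor_sqrt γ).mul hηc)
      fun w ↦ mul_ne_zero (hs w) (hη w)
  have hfin : {x : ℂ | x ^ 24 = 1}.Finite := by
    refine (Polynomial.nthRootsFinset 24 (1 : ℂ)).finite_toSet.subset fun x hx ↦ ?_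
    simpa [Polynomial.mem_nthRootsFinset] using hx
  have key := isPreconnected_univ.constant_of_mapsTo hfin.isDiscrete
    hR.continuousOn (fun w _ ↦ eta_ratio_pow γ w) (Set.mem_univ z)
    (Set.mem_univ UpperHalfPlane.I)
  have h2 : ModularForm.eta ((γ • z : ℍ) : ℂ) /
      (autFactor γ z ^ (1 / 2 : ℂ) * ModularForm.eta (z : ℂ)) = etaMultiplier γ := key
  rw [div_eq_iff (mul_ne_zero (hs z) (hη z))] at h2
  rw [h2, mul_assoc]

/-- The slash operator of real weight `k` (principal branch) for `γ` in `SL₂(ℤ)`: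
`(f|_k γ)(z) = (c z + d)^{-k} f(γ z)`. -/
def slash (k : ℝ) (f : ℍ → ℂ) (γ : SL(2, ℤ)) : ℍ → ℂ :=
  fun z ↦ autFactor γ z ^ (-(k : ℂ)) * f (γ • z)

/-- `f` is a cusp form of weight `k` and multiplier `ν` on `SL₂(ℤ)`. There is only one cusp. -/
structure IsCuspForm (k : ℝ) (ν : SL(2, ℤ) → ℂ) (f : ℍ → ℂ) : Prop where
  holo : MDiff f
  transform : ∀ γ : SL(2, ℤ), slash k f γ = ν γ • f
  zero_at_infty : UpperHalfPlane.IsZeroAtImInfty f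

variable {K : Type*} [Field K]

/-- `f = ∑ a(n) q^{n/24}`, where the power series `F = ∑ a(n) Xⁿ` over `K` stands for the
expansion (`X = q^{1/24} = exp(2πiz/24)`) and `ι` embeds `K` into `ℂ`. -/
def HasFourierExpansion (ι : K →+* ℂ) (f : ℍ → ℂ) (F : K⟦X⟧) : Prop :=
  ∀ z : ℍ, HasSum
    (fun n : ℕ ↦ ι (PowerSeries.coeff n F) * Complex.exp (2 * Real.pi * Complex.I * z / 24) ^ n)
    (f z)

/-- The series `∑_{n ≥ 1} a(n) q^{n/24}`. -/
def series (a : ℕ → K) : K⟦X⟧ := PowerSeries.mk fun n ↦ if n = 0 then 0 else a n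

/-- `(∑ a(n) q^{n/24}) | U_m = ∑ a(mn) q^{n/24}`. -/
def opU (m : ℕ) (F : K⟦X⟧) : K⟦X⟧ := PowerSeries.mk fun n ↦ PowerSeries.coeff (m * n) F

/-- `(∑ a(n) q^{n/24}) | V_m = ∑ a(n) q^{mn/24}` (for `m` positive). -/
def opV (m : ℕ) (F : K⟦X⟧) : K⟦X⟧ :=
  PowerSeries.mk fun n ↦ if m ∣ n then PowerSeries.coeff (n / m) F else 0

variable [NumberField K]

/-- All coefficients of `F` lie in the ring `𝒪_v` of `v`-integral elements of `K`. -/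
def VIntegral (v : IsDedekindDomain.HeightOneSpectrum (𝓞 K)) (F : K⟦X⟧) : Prop :=
  ∀ n : ℕ, v.valuation K (PowerSeries.coeff n F) ≤ 1

/-- `F ≡ G (mod v)`: all coefficients of `F - G` lie in the maximal ideal of `𝒪_v`. -/
def CongrMod (v : IsDedekindDomain.HeightOneSpectrum (𝓞 K)) (F G : K⟦X⟧) : Prop :=
  ∀ n : ℕ, v.valuation K (PowerSeries.coeff n F - PowerSeries.coeff n G) < 1

/-- The space `S_k(1, ν_η^r)` of cusp forms of weight `k` and multiplier `ν_η^r` on `SL₂(ℤ)` with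
Fourier coefficients in `𝒪_v`. A form is recorded by its Fourier expansion. -/
def cuspSpace (ι : K →+* ℂ) (v : IsDedekindDomain.HeightOneSpectrum (𝓞 K)) (k : ℝ) (r : ℕ) :
    Set K⟦X⟧ :=
  {F | VIntegral v F ∧
    ∃ f : ℍ → ℂ, IsCuspForm k (fun γ ↦ etaMultiplier γ ^ r) f ∧ HasFourierExpansion ι f F}

end EtaForms

end

open EtaForms

/-!
Write `θ = q d/dq` and let `k` be the residue field of `v`. Multiplied by a power `η^{ℓt}` with
`0 < t < 24` and `r + ℓt ≡ 0` modulo `24`, the form `g` becomes a form `P` of level one and integral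
weight `W`. By induction on the weight (`exists_polynomial_of_modularForm`), `P` is an isobaric
polynomial in `E₄` and `E₆` over `𝒪_v`, so that reduction modulo `v` turns the question into one on
`k[E₄, E₆]`. Modulo `v` both `g` and `η^{ℓt}` are series in `q^ℓ`, hence `θ P = 0`.

The main point is that a form `P` over `k` with `θ P = 0` has the expansion of an `ℓ`-th power `H^ℓ`
where `H` has weight at most `W / ℓ` (`exists_pow_of_theta_eq_zero`). Let `A` be the reduction of
`E_{ℓ-1}`, whose expansion is `1` by the theorem of von Staudt and Clausen (`exists_hasse`). The
polynomial `P A^W` has weight `ℓ W`; the Euler derivation kills it as its weight is `0` in `k`, and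
the Serre derivation kills it as `θ P = 0`. Together the two derivations express `Δ` times the
partial derivatives, so these vanish and `P A^W` is an `ℓ`-th power. As `A` is squarefree
(`squarefree_hasse`, which follows from the differential equation `∂∂A = -E₄ A`), surplus factors
`A^ℓ` can be cancelled from `H^ℓ = P A^j` until the weight is small enough.

The series `H` vanishes at the cusp and so is `Δ` times a form `h`. Comparing `ℓ`-th powers with
Frobenius twists and cancelling `η^t` from `Δ = η^24` gives `g | U_ℓ ≡ η^{24-t} h'` for a twist `h'`
of `h` (`exists_eta_pow_mul_qExp`). Any isobaric lift of `h'` to `𝒪_v`, times `η^{24-t}`, is the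
form sought.
-/

/-! ### Expansions in powers of `q^{1/h}` -/

namespace EtaForms

open UpperHalfPlane Function ModularForm Filter Topology

/-- `f` is given on all of `ℍ` by the convergent expansion `∑ Fₙ qₕⁿ` in `qₕ = exp(2πiz/h)`. -/
def HasQExp (h : ℝ) (f : ℍ → ℂ) (F : ℂ⟦X⟧) : Prop :=
  ∀ τ : ℍ, HasSum (fun n : ℕ ↦ PowerSeries.coeff n F * Periodic.qParam h τ ^ n) (f τ)

theorem hasFourierExpansion_iff {K : Type*} [Field K] (ι : K →+* ℂ) (f : ℍ → ℂ) (F : K⟦X⟧) :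
    HasFourierExpansion ι f F ↔ HasQExp 24 f (F.map ι) := by
  simp [HasFourierExpansion, HasQExp, Periodic.qParam]

namespace HasQExp

variable {h : ℝ} {f g : ℍ → ℂ} {F G : ℂ⟦X⟧}

theorem add (hf : HasQExp h f F) (hg : HasQExp h g G) : HasQExp h (f + g) (F + G) := fun τ ↦ by
  simpa [add_mul] using (hf τ).add (hg τ)

theorem sub (hf : HasQExp h f F) (hg : HasQExp h g G) : HasQExp h (f - g) (F - G) := fun τ ↦ by
  simpa [sub_mul] using (hf τ).sub (hg τ)

theorem smul (c : ℂ) (hf : HasQExp h f F) : HasQExp h (c • f) (c • F) := fun τ ↦ by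
  simpa [mul_assoc] using (hf τ).mul_left c

theorem const (h : ℝ) (c : ℂ) : HasQExp h (fun _ ↦ c) (PowerSeries.C c) := fun τ ↦ by
  convert! hasSum_ite_eq (0 : ℕ) c using 2 with n
  by_cases hn : n = 0 <;> simp [PowerSeries.coeff_C, hn]

theorem mul (hf : HasQExp h f F) (hg : HasQExp h g G) : HasQExp h (f * g) (F * G) := fun τ ↦ by
  have hF := (hf τ).summable.norm
  have hG := (hg τ).summable.norm
  have key : (fun n : ℕ ↦ PowerSeries.coeff n (F * G) * Periodic.qParam h τ ^ n) = fun n ↦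
      ∑ kl ∈ Finset.HasAntidiagonal.antidiagonal n,
        (PowerSeries.coeff kl.1 F * Periodic.qParam h τ ^ kl.1) *
          (PowerSeries.coeff kl.2 G * Periodic.qParam h τ ^ kl.2) := by
    funext n
    rw [PowerSeries.coeff_mul, Finset.sum_mul]
    refine Finset.sum_congr rfl fun p hp ↦ ?_
    rw [← Finset.HasAntidiagonal.mem_antidiagonal.1 hp, pow_add]
    ring
  rw [key, Pi.mul_apply, ← (hf τ).tsum_eq, ← (hg τ).tsum_eq,
    tsum_mul_tsum_eq_tsum_sum_antidiagonal_of_summable_norm hF hG]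
  exact (summable_norm_sum_mul_antidiagonal_of_summable_norm hF hG).of_norm.hasSum

theorem pow (hf : HasQExp h f F) (n : ℕ) : HasQExp h (f ^ n) (F ^ n) := by
  induction n with
  | zero => exact const h 1
  | succ n ih => simpa [pow_succ] using ih.mul hf

theorem unique (hh : 0 < h) (hf : HasQExp h f F) (hg : HasQExp h f G) : F = G := by
  rw [← sub_eq_zero]
  have h0 : HasQExp h 0 (F - G) := by simpa using hf.sub hg
  have hc : cuspFunction h (⇑(0 : C(ℍ, ℂ))) = 0 := by
    simpa [cuspFunction, Periodic.cuspFunction]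
      using! (tendsto_const_nhds.mono_left nhdsWithin_le_nhds).limUnder_eq
  ext n
  rw [qExpansion_coeff_unique (0 : C(ℍ, ℂ)) hh (by rw [hc]; exact analyticAt_const) h0 n,
    ContinuousMap.coe_zero, qExpansion_zero]

/-- An expansion in `q = exp(2πiz)` is one in `exp(2πiz/24)`, with exponents multiplied by `24`. -/
theorem expand (hf : HasQExp 1 f F) :
    HasQExp 24 f (PowerSeries.expand 24 (by norm_num) F) := fun τ ↦ by
  have hq : Periodic.qParam 24 (τ : ℂ) ^ 24 = Periodic.qParam 1 (τ : ℂ) := by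
    simp only [Periodic.qParam, ← Complex.exp_nat_mul]
    congr 1
    push_cast
    ring
  have hinj : Injective fun n : ℕ ↦ 24 * n := fun a b hab ↦ by simpa using hab
  rw [← hinj.hasSum_iff]
  · convert! hf τ using 2 with n
    simp [PowerSeries.coeff_expand_mul, pow_mul, hq]
  · intro n hn
    rw [PowerSeries.coeff_expand_of_not_dvd, zero_mul]
    rintro ⟨m, rfl⟩
    exact hn ⟨m, rfl⟩

/-- Termwise differentiation: `D = (2πi)⁻¹ d/dz` acts on `q`-expansions as `q d/dq`. -/
theorem normalizedDeriv (hf : HasQExp 1 f F) :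
    HasQExp 1 (Derivative.normalizedDerivOfComplex f)
      (PowerSeries.X * PowerSeries.derivative ℂ F) := fun τ ↦ by
  set a : ℕ → ℂ := fun n ↦ PowerSeries.coeff n F
  -- On the half plane `im z > im τ / 2` the terms are dominated by their values at `iτ / 2`.
  let U : Set ℂ := {z | τ.im / 2 < z.im}
  have hU : IsOpen U := isOpen_lt continuous_const Complex.continuous_im
  have hτU : (τ : ℂ) ∈ U := by
    have := τ.im_pos
    simp only [U, Set.mem_ofPred_eq, coe_im]
    linarith
  let σ : ℍ := ⟨Complex.I * (τ.im / 2 : ℝ), by simpa using τ.im_pos⟩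
  have hnorm : ∀ (z : ℂ), ‖Periodic.qParam 1 z‖ = Real.exp (-2 * Real.pi * z.im) := fun z ↦ by
    simpa using Periodic.norm_qParam 1 z
  have hle : ∀ (n : ℕ) (w : ℂ), w ∈ U → ‖a n * Periodic.qParam 1 w ^ n‖ ≤
      ‖a n * Periodic.qParam 1 (σ : ℂ) ^ n‖ := fun n w hw ↦ by
    rw [norm_mul, norm_mul, norm_pow, norm_pow, hnorm, hnorm]
    have hσ : (σ : ℂ).im = τ.im / 2 := by simp [σ]
    have hw' : τ.im / 2 < w.im := hw
    gcongr ‖a n‖ * ?_ ^ n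
    rw [hσ]
    apply Real.exp_le_exp.2
    nlinarith [Real.pi_pos]
  have hd := Complex.hasSum_deriv_of_summable_norm (hf σ).summable.norm
    (F := fun n w ↦ a n * Periodic.qParam 1 w ^ n) (fun n ↦ by
      have : Differentiable ℂ fun w : ℂ ↦ Periodic.qParam 1 w :=
        Periodic.differentiable_qParam
      exact (((this.pow n).const_mul (a n))).differentiableOn) hU hle hτU
  have hev : (fun w : ℂ ↦ ∑' n, a n * Periodic.qParam 1 w ^ n) =ᶠ[𝓝 (τ : ℂ)]
      f ∘ ofComplex := by
    filter_upwards [isOpen_upperHalfPlaneSet.mem_nhds τ.im_pos] with w hw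
    have := (hf ⟨w, hw⟩).tsum_eq
    rw [Function.comp_apply, ofComplex_apply_of_im_pos hw]
    exact this
  rw [hev.deriv_eq] at hd
  have hterm : ∀ n, deriv (fun w : ℂ ↦ a n * Periodic.qParam 1 w ^ n) τ =
      a n * (n * (2 * Real.pi * Complex.I) * Periodic.qParam 1 (τ : ℂ) ^ n) := fun n ↦ by
    have h1 : HasDerivAt (fun w : ℂ ↦ a n * Periodic.qParam 1 w ^ n)
        (a n * (Complex.exp (n * (2 * Real.pi * Complex.I * τ)) *
          (n * (2 * Real.pi * Complex.I)))) τ := by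
      have h2 : (fun w : ℂ ↦ a n * Periodic.qParam 1 w ^ n) =
          fun w ↦ a n * Complex.exp (n * (2 * Real.pi * Complex.I * w)) := by
        funext w
        simp [Periodic.qParam, ← Complex.exp_nat_mul]
      rw [h2]
      refine HasDerivAt.const_mul _ (HasDerivAt.cexp ?_)
      simpa using ((hasDerivAt_id (τ : ℂ)).const_mul (2 * Real.pi * Complex.I)).const_mul (n : ℂ)
    rw [h1.deriv]
    simp only [Periodic.qParam, ← Complex.exp_nat_mul]
    push_cast
    ring_nf
  simp only [hterm] at hd
  have hpi : (2 * Real.pi * Complex.I : ℂ) ≠ 0 := by simp [Real.pi_ne_zero]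
  convert! hd.mul_left (2 * Real.pi * Complex.I)⁻¹ using 2 with n
  cases n with
  | zero => simp
  | succ n =>
    rw [PowerSeries.coeff_succ_X_mul, PowerSeries.coeff_derivative]
    simp only [a]
    push_cast
    field_simp

end HasQExp

end EtaForms

/-! ### The integral expansion of the eta function -/

namespace EtaForms

open UpperHalfPlane Function ModularForm Filter Topology

theorem iteratedDeriv_polynomial_eval_zero (p : Polynomial ℂ) (n : ℕ) :
    iteratedDeriv n (fun q : ℂ ↦ p.eval q) 0 = n.factorial * p.coeff n := by
  have h : ∀ n : ℕ, iteratedDeriv n (fun q : ℂ ↦ p.eval q) =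
      fun q ↦ (Polynomial.derivative^[n] p).eval q := fun n ↦ by
    induction n with
    | zero => simp
    | succ n ih =>
      rw [iteratedDeriv_succ, ih, Function.iterate_succ_apply']
      funext q
      exact Polynomial.deriv _
  rw [h]
  beta_reduce
  rw [← Polynomial.coeff_zero_eq_eval_zero, Polynomial.coeff_iterate_derivative]
  simp [Nat.descFactorial_self]

/-- Euler's product `∏ (1 - qⁿ)` has the pentagonal numbers series as Taylor expansion: its Taylor
coefficients are the limits of those of the finite partial products. -/
theorem iteratedDeriv_euler_product (n : ℕ) :
    iteratedDeriv n (fun q : ℂ ↦ ∏' i, (1 - q ^ (i + 1))) 0 =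
      n.factorial * PowerSeries.coeff n (PowerSeries.pentagonalSeries ℂ) := by
  set P : Finset ℕ → ℂ → ℂ := fun s q ↦ ∏ i ∈ s, (1 - q ^ (i + 1))
  have hP : ∀ s, Differentiable ℂ (P s) := fun s ↦ by
    have : P s = ∏ i ∈ s, fun q : ℂ ↦ (1 - q ^ (i + 1)) := by
      funext q; simp [P]
    rw [this]
    exact Differentiable.finsetProd fun i _ ↦ by fun_prop
  have hlim : ∀ m : ℕ, TendstoLocallyUniformlyOn (fun s ↦ iteratedDeriv m (P s))
      (iteratedDeriv m fun q : ℂ ↦ ∏' i, (1 - q ^ (i + 1))) atTop (Metric.ball 0 1) := fun m ↦ by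
    induction m with
    | zero =>
      simpa [P] using! multipliableLocallyUniformlyOn_one_sub_pow.hasProdLocallyUniformlyOn
    | succ m ih =>
      have := ih.deriv (Eventually.of_forall fun s ↦
        (((hP s).contDiff (n := ⊤)).differentiable_iteratedDeriv m (by
          exact_mod_cast WithTop.coe_lt_top _)).differentiableOn) Metric.isOpen_ball
      simpa [iteratedDeriv_succ, Function.comp_def] using! this
  have h0 := (hlim n).tendsto_at (a := 0) (by simp)
  refine tendsto_nhds_unique h0 (tendsto_nhds_of_eventually_eq ?_)
  filter_upwards [PowerSeries.coeff_prod_one_sub_X_pow_eventually_eq ℂ n] with s hs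
  have hpoly : P s = fun q ↦ (∏ i ∈ s, (1 - Polynomial.X ^ (i + 1)) : Polynomial ℂ).eval q := by
    funext q
    simp [P, Polynomial.eval_prod]
  rw [hpoly, iteratedDeriv_polynomial_eval_zero, ← hs, ← Polynomial.coeff_coe]
  congr 2
  rw [← Polynomial.coeToPowerSeries.ringHom_apply, map_prod]
  simp

/-- The integral expansion of `η` in powers of `q^{1/24}`: the variable stands for `q^{1/24}`, so
that Euler's product, a series in `q`, is expanded by `24`. -/
noncomputable def etaSeries : ℤ⟦X⟧ :=
  PowerSeries.X * PowerSeries.expand 24 (by norm_num) (PowerSeries.pentagonalSeries ℤ)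

theorem map_pentagonalSeries {S : Type*} [CommRing S] :
    (PowerSeries.pentagonalSeries ℤ).map (Int.castRingHom S) = PowerSeries.pentagonalSeries S := by
  ext n
  simp only [PowerSeries.coeff_map, PowerSeries.pentagonalSeries, PowerSeries.coeff_mk]
  split_ifs <;> simp

theorem constantCoeff_pentagonalSeries {S : Type*} [CommRing S] :
    PowerSeries.constantCoeff (PowerSeries.pentagonalSeries S) = 1 := by
  have := PowerSeries.coeff_pentagonalSeries_pentagonal S 0
  simpa [pentagonal] using this

theorem hasQExp_euler_product : HasQExp 1 (fun z : ℍ ↦ ∏' n, (1 - eta_q n z))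
    (PowerSeries.pentagonalSeries ℂ) := fun τ ↦ by
  have hτ : Periodic.qParam 1 (τ : ℂ) ∈ Metric.ball (0 : ℂ) 1 := by
    simpa using norm_qParam_lt_one 1 τ
  have := Complex.hasSum_taylorSeries_on_ball differentiableOn_tprod_one_sub_pow hτ
  convert! this using 2 with n
  rw [iteratedDeriv_euler_product]
  have : (n.factorial : ℂ) ≠ 0 := by exact_mod_cast n.factorial_ne_zero
  simp only [sub_zero, smul_eq_mul]
  field_simp

theorem hasQExp_qParam : HasQExp 24 (fun z : ℍ ↦ Periodic.qParam 24 z) PowerSeries.X := fun τ ↦ by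
  convert! hasSum_ite_eq (1 : ℕ) (Periodic.qParam 24 (τ : ℂ)) using 2 with n
  by_cases hn : n = 1 <;> simp [PowerSeries.coeff_X, hn]

theorem hasQExp_eta : HasQExp 24 (fun z : ℍ ↦ eta (z : ℂ)) (etaSeries.map (Int.castRingHom ℂ)) := by
  have h := hasQExp_qParam.mul hasQExp_euler_product.expand
  rw [← map_pentagonalSeries, ← PowerSeries.map_expand] at h
  simpa [etaSeries] using! h

theorem hasQExp_discriminant : HasQExp 1 discriminant
    ((PowerSeries.X * PowerSeries.pentagonalSeries ℤ ^ 24).map (Int.castRingHom ℂ)) := by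
  have hX : HasQExp 1 (fun z : ℍ ↦ Periodic.qParam 1 z) PowerSeries.X := fun τ ↦ by
    convert! hasSum_ite_eq (1 : ℕ) (Periodic.qParam 1 (τ : ℂ)) using 2 with n
    by_cases hn : n = 1 <;> simp [PowerSeries.coeff_X, hn]
  have h := hX.mul (hasQExp_euler_product.pow 24)
  have hΔ : discriminant = (fun z : ℍ ↦ Periodic.qParam 1 (z : ℂ)) *
      (fun z : ℍ ↦ ∏' n, (1 - eta_q n z)) ^ 24 := by
    funext z
    rw [discriminant_eq_q_prod, Pi.mul_apply, Pi.pow_apply,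
      (multipliableLocallyUniformlyOn_eta.multipliable z.2).tprod_pow]
  rw [hΔ, map_mul, map_pow, map_pentagonalSeries, PowerSeries.map_X]
  exact h

end EtaForms

/-! ### Ramanujan's differential equations -/

namespace EtaForms

open UpperHalfPlane Function ModularForm Filter Topology EisensteinSeries Derivative
open scoped ArithmeticFunction.sigma

/-- The `q`-expansion of `E₂`. -/
noncomputable def e2Series : ℤ⟦X⟧ :=
  PowerSeries.mk fun n ↦ if n = 0 then 1 else -24 * (σ 1 n : ℤ)

/-- The `q`-expansion of `E₄`. -/
noncomputable def e4Series : ℤ⟦X⟧ :=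
  PowerSeries.mk fun n ↦ if n = 0 then 1 else 240 * (σ 3 n : ℤ)

/-- The `q`-expansion of `E₆`. -/
noncomputable def e6Series : ℤ⟦X⟧ :=
  PowerSeries.mk fun n ↦ if n = 0 then 1 else -504 * (σ 5 n : ℤ)

theorem hasQExp_modularForm {k : ℤ} (f : ModularForm 𝒮ℒ k) : HasQExp 1 f (qExpansion 1 f) :=
  fun τ ↦ ModularForm.hasSum_qExpansion f one_pos (by simp) τ

theorem hasQExp_E2 : HasQExp 1 E2 (e2Series.map (Int.castRingHom ℂ)) := fun τ ↦ by
  convert! hasSum_qExpansion_E2 (z := τ) using 2 with n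
  by_cases hn : n = 0 <;> simp [e2Series, hn, Periodic.qParam]

theorem hasQExp_E4 : HasQExp 1 E₄ (e4Series.map (Int.castRingHom ℂ)) := by
  convert! hasQExp_modularForm E₄
  ext n
  rw [E_qExpansion_coeff _ ⟨2, rfl⟩, show bernoulli 4 = -1 / 30 by decide +kernel]
  by_cases hn : n = 0 <;> simp [e4Series, hn]
  norm_num

theorem hasQExp_E6 : HasQExp 1 E₆ (e6Series.map (Int.castRingHom ℂ)) := by
  convert! hasQExp_modularForm E₆
  ext n
  rw [E_qExpansion_coeff _ ⟨3, rfl⟩, show bernoulli 6 = 1 / 42 by decide +kernel]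
  by_cases hn : n = 0 <;> simp [e6Series, hn]
  norm_num

/-- Boundedness at the only cusp is read off from the expansion. -/
theorem exists_modularForm {k : ℤ} {h : ℝ} {f : ℍ → ℂ} {F : ℂ⟦X⟧} (hd : MDiff f)
    (hinv : ∀ γ : SL(2, ℤ), f ∣[k] γ = f) (hh : 0 < h) (hf : HasQExp h f F) :
    ∃ M : ModularForm 𝒮ℒ k, ⇑M = f := by
  refine ⟨{ toFun := f, slash_action_eq' := ?_, holo' := hd, bdd_at_cusps' := ?_ }, rfl⟩
  · rintro _ ⟨γ, rfl⟩
    exact hinv γ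
  · intro c hc
    rw [Subgroup.IsArithmetic.isCusp_iff_isCusp_SL2Z] at hc
    rw [OnePoint.isBoundedAt_iff_forall_SL2Z hc]
    intro γ _
    rw [hinv γ]
    exact isBoundedAtImInfty_of_hasSum_qExpansion hh hf

/-- In weight less than `12` a level one form is determined by its constant term. -/
theorem qExp_eq_of_constantCoeff_eq {k : ℤ} (hk : k < 12) {f g : ModularForm 𝒮ℒ k} {F G : ℂ⟦X⟧}
    (hf : HasQExp 1 f F) (hg : HasQExp 1 g G)
    (h0 : PowerSeries.constantCoeff F = PowerSeries.constantCoeff G) : F = G := by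
  have hfg : HasQExp 1 (f - g : ModularForm 𝒮ℒ k) (F - G) := by simpa using hf.sub hg
  have hq : qExpansion 1 (f - g : ModularForm 𝒮ℒ k) = F - G :=
    (hasQExp_modularForm _).unique one_pos hfg
  have hz : f - g = 0 := by
    refine sturm_bound_levelOne ?_
    rw [show k.toNat / 12 = 0 by omega, hq, Nat.cast_zero, pos_iff_ne_zero]
    intro h
    have hu := (PowerSeries.order_eq_nat (n := 0)).1 (by simpa using h)
    simp [h0] at hu
  rw [← sub_eq_zero, ← hq, hz]
  exact qExpansion_zero 1

theorem hasQExp_serreDerivative {k : ℂ} {f : ℍ → ℂ} {F : ℂ⟦X⟧} (hf : HasQExp 1 f F) :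
    HasQExp 1 (serreDerivative k f) (PowerSeries.X * PowerSeries.derivative ℂ F -
      (k * 12⁻¹) • (e2Series.map (Int.castRingHom ℂ) * F)) := by
  have := hf.normalizedDeriv.sub ((hasQExp_E2.mul hf).smul (k * 12⁻¹))
  convert! this using 1
  funext z
  simp [mul_assoc]

theorem modularForm_slash {k : ℤ} (f : ModularForm 𝒮ℒ k) (γ : SL(2, ℤ)) : ⇑f ∣[k] γ = f :=
  SlashInvariantForm.slash_action_eqn f _ ⟨γ, rfl⟩

theorem exists_serreDerivative {k : ℤ} (f : ModularForm 𝒮ℒ k) :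
    ∃ M : ModularForm 𝒮ℒ (k + 2), ⇑M = serreDerivative k f :=
  exists_modularForm (serreDerivative_mdifferentiable _ f.holo')
    (fun γ ↦ serreDerivative_slash_invariant f.holo' (modularForm_slash f γ))
    one_pos (hasQExp_serreDerivative (hasQExp_modularForm f))

/-- `E₂' - E₂²/12` is modular of weight `4`, although `E₂` is not modular: the anomaly of `E₂`
cancels. -/
theorem exists_derivative_E2 :
    ∃ M : ModularForm 𝒮ℒ 4, ⇑M = normalizedDerivOfComplex E2 - (12⁻¹ : ℂ) • (E2 * E2) := by
  refine exists_modularForm ((normalizedDerivOfComplex_mdifferentiable E2_mdifferentiable).sub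
    ((E2_mdifferentiable.mul E2_mdifferentiable).const_smul _)) (fun γ ↦ ?_)
    one_pos (hasQExp_E2.normalizedDeriv.sub ((hasQExp_E2.mul hasQExp_E2).smul _))
  -- `u = c / (cz + d)` measures the failure of modularity: `E₂|γ = E₂ - (6i/π) u`.
  set u : ℍ → ℂ := fun z ↦ (γ 1 0 : ℂ) / denom γ z with hu
  have hE : ∀ z, (E2 ∣[(2 : ℤ)] γ) z = E2 z - 6 * Complex.I / Real.pi * u z := fun z ↦ by
    rw [E2_slash_action]
    simp only [Pi.sub_apply, Pi.smul_apply, smul_eq_mul, D2, riemannZeta_two, hu]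
    field_simp
  have hdenom : ∀ w : ℍ, HasDerivAt (fun w : ℂ ↦ (γ 1 0 : ℂ) / ((γ 1 0 : ℂ) * w + (γ 1 1 : ℂ)))
      (-(u w) ^ 2) w := fun w ↦ by
    have hne : (γ 1 0 : ℂ) * w + (γ 1 1 : ℂ) ≠ 0 := autFactor_ne_zero γ w
    have h1 : HasDerivAt (fun w : ℂ ↦ (γ 1 0 : ℂ) * w + (γ 1 1 : ℂ)) (γ 1 0 : ℂ) w := by
      simpa using ((hasDerivAt_id (w : ℂ)).const_mul (γ 1 0 : ℂ)).add_const (γ 1 1 : ℂ)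
    refine ((hasDerivAt_const (w : ℂ) (γ 1 0 : ℂ)).div h1 hne).congr_deriv ?_
    simp only [hu, ← autFactor_eq_denom, autFactor]
    field_simp
    ring
  have hD : ∀ z, normalizedDerivOfComplex (E2 ∣[(2 : ℤ)] γ) z = normalizedDerivOfComplex E2 z -
      6 * Complex.I / Real.pi * ((2 * Real.pi * Complex.I)⁻¹ * -(u z) ^ 2) := fun z ↦ by
    have hev : (E2 ∣[(2 : ℤ)] γ) ∘ ofComplex =ᶠ[𝓝 (z : ℂ)] fun w ↦ (E2 ∘ ofComplex) w -
        6 * Complex.I / Real.pi * ((γ 1 0 : ℂ) / ((γ 1 0 : ℂ) * w + (γ 1 1 : ℂ))) := by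
      filter_upwards [isOpen_upperHalfPlaneSet.mem_nhds z.im_pos] with w hw
      rw [Function.comp_apply, Function.comp_apply, ofComplex_apply_of_im_pos hw, hE]
      simp only [hu, ← autFactor_eq_denom, autFactor]
    have hE2 : HasDerivAt (E2 ∘ ofComplex) (deriv (E2 ∘ ofComplex) z) z :=
      (mdifferentiableAt_iff.mp (E2_mdifferentiable z)).hasDerivAt
    simp only [normalizedDerivOfComplex]
    have hd : HasDerivAt (fun w ↦ (E2 ∘ ofComplex) w - 6 * Complex.I / Real.pi *
        ((γ 1 0 : ℂ) / ((γ 1 0 : ℂ) * w + (γ 1 1 : ℂ)))) _ (z : ℂ) :=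
      hE2.sub ((hdenom z).const_mul (6 * Complex.I / Real.pi))
    rw [hev.deriv_eq, hd.deriv]
    ring
  have hmul := congrFun (ModularForm.mul_slash_SL2 2 2 γ E2 E2)
  have hS := congrFun (normalizedDerivOfComplex_SL_slash (k := 2) E2_mdifferentiable (γ := γ))
  funext z
  have hmz := hmul z
  have hSz := hS z
  rw [hD z] at hSz
  simp only [Pi.sub_apply, Pi.mul_apply, hE, show (2 : ℤ) + 2 = 4 by norm_num] at hmz hSz
  have hdist : ((normalizedDerivOfComplex E2 - (12⁻¹ : ℂ) • (E2 * E2)) ∣[(4 : ℤ)] γ) z =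
      (normalizedDerivOfComplex E2 ∣[(4 : ℤ)] γ) z - 12⁻¹ * ((E2 * E2) ∣[(4 : ℤ)] γ) z := by
    simp only [ModularForm.SL_slash_apply, Pi.sub_apply, Pi.smul_apply, smul_eq_mul]
    ring
  rw [hdist, hmz, eq_add_of_sub_eq' hSz.symm]
  simp only [Pi.sub_apply, Pi.smul_apply, Pi.mul_apply, smul_eq_mul]
  have hpi : (Real.pi : ℂ) ≠ 0 := by exact_mod_cast Real.pi_ne_zero
  have hI : Complex.I ^ 2 = -1 := Complex.I_sq
  change (2 : ℂ) * (2 * Real.pi * Complex.I)⁻¹ * u z * _ + _ - _ = _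
  field_simp
  linear_combination (-(72 : ℂ) * u z ^ 2 * Complex.I + 24 * u z * Real.pi * E2 z) * hI

/-- The operator `q d/dq` on power series. -/
noncomputable def theta (S : Type*) [CommRing S] : Derivation S S⟦X⟧ S⟦X⟧ :=
  (PowerSeries.X : S⟦X⟧) • PowerSeries.derivative S

theorem theta_apply {S : Type*} [CommRing S] (F : S⟦X⟧) :
    theta S F = PowerSeries.X * PowerSeries.derivative S F := rfl

theorem coeff_theta {S : Type*} [CommRing S] (F : S⟦X⟧) (n : ℕ) :
    PowerSeries.coeff n (theta S F) = n * PowerSeries.coeff n F := by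
  cases n with
  | zero => simp [theta_apply]
  | succ n =>
    rw [theta_apply, PowerSeries.coeff_succ_X_mul, PowerSeries.coeff_derivative]
    push_cast
    ring

theorem map_theta {S T : Type*} [CommRing S] [CommRing T] (j : S →+* T) (F : S⟦X⟧) :
    (theta S F).map j = theta T (F.map j) := by
  ext n
  simp [coeff_theta]

theorem map_castRingHom_injective :
    Injective (PowerSeries.map (Int.castRingHom ℂ)) := by
  intro F G h
  ext n
  have := congrArg (PowerSeries.coeff n) h
  simpa using this

theorem constantCoeff_map {S T : Type*} [CommRing S] [CommRing T] (j : S →+* T) (F : S⟦X⟧) :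
    PowerSeries.constantCoeff (F.map j) = j (PowerSeries.constantCoeff F) := by
  rw [← PowerSeries.coeff_zero_eq_constantCoeff_apply, PowerSeries.coeff_map,
    PowerSeries.coeff_zero_eq_constantCoeff_apply]

theorem constantCoeff_e2Series : PowerSeries.constantCoeff e2Series = 1 := by
  rw [← PowerSeries.coeff_zero_eq_constantCoeff_apply]; simp [e2Series]

theorem constantCoeff_e4Series : PowerSeries.constantCoeff e4Series = 1 := by
  rw [← PowerSeries.coeff_zero_eq_constantCoeff_apply]; simp [e4Series]

theorem constantCoeff_e6Series : PowerSeries.constantCoeff e6Series = 1 := by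
  rw [← PowerSeries.coeff_zero_eq_constantCoeff_apply]; simp [e6Series]

/-- Ramanujan's identity for the derivative of `E₂`. -/
theorem theta_e2Series : 12 * theta ℤ e2Series = e2Series ^ 2 - e4Series := by
  obtain ⟨M, hM⟩ := exists_derivative_E2
  have h1 : HasQExp 1 M _ := hM ▸
    hasQExp_E2.normalizedDeriv.sub ((hasQExp_E2.mul hasQExp_E2).smul 12⁻¹)
  have h2 : HasQExp 1 ((-12⁻¹ : ℂ) • E₄ : ModularForm 𝒮ℒ 4) _ := hasQExp_E4.smul (-12⁻¹ : ℂ)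
  have h := qExp_eq_of_constantCoeff_eq (by norm_num) h1 h2 (by
    simp [constantCoeff_map, constantCoeff_e2Series, constantCoeff_e4Series])
  apply map_castRingHom_injective
  rw [← theta_apply, ← map_theta] at h
  simp only [map_mul, map_sub, map_pow, map_ofNat, PowerSeries.smul_eq_C_mul] at h ⊢
  have h12 : (PowerSeries.C (12⁻¹ : ℂ)) * 12 = 1 := by
    rw [← map_ofNat (PowerSeries.C (R := ℂ)) 12, ← map_mul]; norm_num
  rw [map_neg] at h
  linear_combination 12 * h +
    ((e2Series.map (Int.castRingHom ℂ)) ^ 2 - e4Series.map (Int.castRingHom ℂ)) * h12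

/-- Ramanujan's identity for the derivative of `E₄`. -/
theorem theta_e4Series : 3 * theta ℤ e4Series = e2Series * e4Series - e6Series := by
  obtain ⟨M, hM⟩ := exists_serreDerivative E₄
  have h1 : HasQExp 1 M _ := hM ▸ hasQExp_serreDerivative hasQExp_E4
  have h2 : HasQExp 1 ((-3⁻¹ : ℂ) • E₆ : ModularForm 𝒮ℒ 6) _ := hasQExp_E6.smul (-3⁻¹ : ℂ)
  have h := qExp_eq_of_constantCoeff_eq (by norm_num) h1 h2 (by
    norm_num [constantCoeff_map, constantCoeff_e2Series, constantCoeff_e4Series,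
      constantCoeff_e6Series])
  apply map_castRingHom_injective
  rw [← theta_apply, ← map_theta] at h
  have h43 : ((4 : ℤ) : ℂ) * 12⁻¹ = 3⁻¹ := by norm_num
  simp only [map_mul, map_sub, map_ofNat, PowerSeries.smul_eq_C_mul, h43] at h ⊢
  have h3 : (PowerSeries.C (3⁻¹ : ℂ)) * 3 = 1 := by
    rw [← map_ofNat (PowerSeries.C (R := ℂ)) 3, ← map_mul]; norm_num
  rw [map_neg] at h
  linear_combination 3 * h + (e2Series.map (Int.castRingHom ℂ) *
    e4Series.map (Int.castRingHom ℂ) - e6Series.map (Int.castRingHom ℂ)) * h3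

/-- Ramanujan's identity for the derivative of `E₆`. -/
theorem theta_e6Series : 2 * theta ℤ e6Series = e2Series * e6Series - e4Series ^ 2 := by
  obtain ⟨M, hM⟩ := exists_serreDerivative E₆
  have h1 : HasQExp 1 M _ := hM ▸ hasQExp_serreDerivative hasQExp_E6
  have h2 : HasQExp 1 ((-2⁻¹ : ℂ) • E₄.mul E₄ : ModularForm 𝒮ℒ 8) _ :=
    (hasQExp_E4.mul hasQExp_E4).smul (-2⁻¹ : ℂ)
  have h := qExp_eq_of_constantCoeff_eq (by norm_num) h1 h2 (by
    norm_num [constantCoeff_map, constantCoeff_e2Series, constantCoeff_e4Series,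
      constantCoeff_e6Series])
  apply map_castRingHom_injective
  rw [← theta_apply, ← map_theta] at h
  have h62 : ((6 : ℤ) : ℂ) * 12⁻¹ = 2⁻¹ := by norm_num
  simp only [map_mul, map_sub, map_pow, map_ofNat, PowerSeries.smul_eq_C_mul, h62] at h ⊢
  have h2 : (PowerSeries.C (2⁻¹ : ℂ)) * 2 = 1 := by
    rw [← map_ofNat (PowerSeries.C (R := ℂ)) 2, ← map_mul]; norm_num
  rw [map_neg] at h
  linear_combination 2 * h + (e2Series.map (Int.castRingHom ℂ) *
    e6Series.map (Int.castRingHom ℂ) - e4Series.map (Int.castRingHom ℂ) ^ 2) * h2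

/-- `E₄³ - E₆² = 1728 Δ`. -/
theorem e4Series_cube_sub_e6Series_sq : e4Series ^ 3 - e6Series ^ 2 =
    1728 * (PowerSeries.X * PowerSeries.pentagonalSeries ℤ ^ 24) := by
  apply map_castRingHom_injective
  have h1 := (hasQExp_E4.pow 3).sub (hasQExp_E6.pow 2)
  have h2 := hasQExp_discriminant.smul 1728
  have hΔ : (1728 : ℂ) • discriminant = (⇑E₄) ^ 3 - (⇑E₆) ^ 2 := by
    funext z
    simp only [Pi.smul_apply, Pi.sub_apply, Pi.pow_apply, smul_eq_mul,
      discriminant_eq_E₄_cube_sub_E₆_sq]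
    ring
  rw [hΔ] at h2
  have h := h1.unique one_pos h2
  rw [PowerSeries.smul_eq_C_mul] at h
  rw [map_sub, map_pow, map_pow, h, map_mul (PowerSeries.map _) 1728,
    map_ofNat, map_ofNat]

end EtaForms

/-! ### Polynomials in the Eisenstein series `E₄` and `E₆` -/

namespace EtaForms

open UpperHalfPlane Function ModularForm

/-- The weights of `E₄` and `E₆`. -/
def wt : Fin 2 → ℕ := ![4, 6]

theorem weight_wt (d : Fin 2 →₀ ℕ) : Finsupp.weight wt d = 4 * d 0 + 6 * d 1 := by
  rw [Finsupp.weight_apply, Finsupp.sum_fintype _ _ (by simp)]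
  simp [wt, mul_comm]

section Ring

variable (S : Type*) [CommRing S]

/-- The `q`-expansion of a polynomial in `E₄` (the variable `X 0`) and `E₆` (the variable `X 1`). -/
noncomputable def qExp : MvPolynomial (Fin 2) S →ₐ[S] S⟦X⟧ :=
  MvPolynomial.aeval
    ![e4Series.map (Int.castRingHom S), e6Series.map (Int.castRingHom S)]

/-- The polynomial `E₄³ - E₆² = 1728 Δ`. -/
noncomputable def disc : MvPolynomial (Fin 2) S := MvPolynomial.X 0 ^ 3 - MvPolynomial.X 1 ^ 2

/-- The derivation `E₄ ↦ -4 E₆`, `E₆ ↦ -6 E₄²`, which is `12` times the Serre derivative. -/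
noncomputable def serreDer : Derivation S (MvPolynomial (Fin 2) S) (MvPolynomial (Fin 2) S) :=
  (-4 * MvPolynomial.X 1 : MvPolynomial (Fin 2) S) • MvPolynomial.pderiv 0 +
    (-6 * MvPolynomial.X 0 ^ 2 : MvPolynomial (Fin 2) S) • MvPolynomial.pderiv 1

/-- The Euler derivation, which multiplies a polynomial of weight `w` by `w`. -/
noncomputable def eulerDer : Derivation S (MvPolynomial (Fin 2) S) (MvPolynomial (Fin 2) S) :=
  (4 * MvPolynomial.X 0 : MvPolynomial (Fin 2) S) • MvPolynomial.pderiv 0 +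
    (6 * MvPolynomial.X 1 : MvPolynomial (Fin 2) S) • MvPolynomial.pderiv 1

variable {S}

@[simp] theorem qExp_X_zero :
    qExp S (MvPolynomial.X 0) = e4Series.map (Int.castRingHom S) := by simp [qExp]

@[simp] theorem qExp_X_one :
    qExp S (MvPolynomial.X 1) = e6Series.map (Int.castRingHom S) := by simp [qExp]

theorem serreDer_apply (p : MvPolynomial (Fin 2) S) : serreDer S p =
    -4 * MvPolynomial.X 1 * MvPolynomial.pderiv 0 p +
      -6 * MvPolynomial.X 0 ^ 2 * MvPolynomial.pderiv 1 p := rfl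

theorem eulerDer_apply (p : MvPolynomial (Fin 2) S) : eulerDer S p =
    4 * MvPolynomial.X 0 * MvPolynomial.pderiv 0 p +
      6 * MvPolynomial.X 1 * MvPolynomial.pderiv 1 p := rfl

@[simp] theorem serreDer_X_zero :
    serreDer S (MvPolynomial.X 0) = -4 * MvPolynomial.X 1 := by simp [serreDer_apply]

@[simp] theorem serreDer_X_one :
    serreDer S (MvPolynomial.X 1) = -6 * MvPolynomial.X 0 ^ 2 := by simp [serreDer_apply]

@[simp] theorem eulerDer_X_zero :
    eulerDer S (MvPolynomial.X 0) = 4 * MvPolynomial.X 0 := by simp [eulerDer_apply]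

@[simp] theorem eulerDer_X_one :
    eulerDer S (MvPolynomial.X 1) = 6 * MvPolynomial.X 1 := by simp [eulerDer_apply]

theorem map_qExp {T : Type*} [CommRing T] (j : S →+* T) (p : MvPolynomial (Fin 2) S) :
    (qExp S p).map j = qExp T (p.map j) := by
  induction p using MvPolynomial.induction_on with
  | C a => simp [qExp]
  | add p q hp hq => simp [hp, hq]
  | mul_X p i hp =>
    rw [map_mul, map_mul, map_mul, map_mul, hp, MvPolynomial.map_X]
    congr 1
    have hcomp : j.comp (Int.castRingHom S) = Int.castRingHom T := RingHom.ext_int _ _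
    fin_cases i <;> simp [← RingHom.comp_apply, ← PowerSeries.map_comp, hcomp]

/-- `Δ = q ∏ (1 - qⁿ)^24`, the product being expanded by the pentagonal number theorem. -/
theorem qExp_disc : qExp S (disc S) =
    1728 * (PowerSeries.X * PowerSeries.pentagonalSeries S ^ 24) := by
  have := congrArg (PowerSeries.map (Int.castRingHom S)) e4Series_cube_sub_e6Series_sq
  simp only [map_sub, map_pow, map_mul, map_ofNat, map_pentagonalSeries, PowerSeries.map_X] at this
  simp [disc, this]

theorem isWeightedHomogeneous_disc : (disc S).IsWeightedHomogeneous wt 12 :=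
  ((MvPolynomial.isWeightedHomogeneous_X S wt 0).pow 3).sub
    ((MvPolynomial.isWeightedHomogeneous_X S wt 1).pow 2)

theorem eulerDer_of_isWeightedHomogeneous {p : MvPolynomial (Fin 2) S} {w : ℕ}
    (hp : p.IsWeightedHomogeneous wt w) : eulerDer S p = w * p := by
  have := hp.sum_weight_X_mul_pderiv
  simp only [Fin.sum_univ_two, nsmul_eq_mul] at this
  rw [eulerDer_apply, ← this]
  simp [wt, mul_assoc]

theorem isWeightedHomogeneous_serreDer {p : MvPolynomial (Fin 2) S} {w : ℕ}
    (hp : p.IsWeightedHomogeneous wt w) : (serreDer S p).IsWeightedHomogeneous wt (w + 2) := by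
  induction hp using MvPolynomial.IsWeightedHomogeneous.induction_on with
  | zero => simpa using MvPolynomial.isWeightedHomogeneous_zero S wt _
  | add p q _ _ hp hq => rw [map_add]; exact hp.add hq
  | monomial d r hd =>
    rw [weight_wt] at hd
    have hX (i : Fin 2) (n : ℕ) : (MvPolynomial.X i ^ n : MvPolynomial (Fin 2) S) =
        MvPolynomial.monomial (Finsupp.single i n) 1 := MvPolynomial.X_pow_eq_monomial
    have h1 : (MvPolynomial.X 1 ^ 1 * MvPolynomial.pderiv 0 (MvPolynomial.monomial d r)
        : MvPolynomial (Fin 2) S).IsWeightedHomogeneous wt (w + 2) := by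
      rw [MvPolynomial.pderiv_monomial, hX, MvPolynomial.monomial_mul]
      rcases Nat.eq_zero_or_pos (d 0) with h0 | h0
      · simpa [h0] using MvPolynomial.isWeightedHomogeneous_zero S wt _
      · refine MvPolynomial.isWeightedHomogeneous_monomial _ _ _ ?_
        rw [weight_wt]
        simp
        omega
    have h2 : (MvPolynomial.X 0 ^ 2 * MvPolynomial.pderiv 1 (MvPolynomial.monomial d r)
        : MvPolynomial (Fin 2) S).IsWeightedHomogeneous wt (w + 2) := by
      rw [MvPolynomial.pderiv_monomial, hX, MvPolynomial.monomial_mul]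
      rcases Nat.eq_zero_or_pos (d 1) with h0 | h0
      · simpa [h0] using MvPolynomial.isWeightedHomogeneous_zero S wt _
      · refine MvPolynomial.isWeightedHomogeneous_monomial _ _ _ ?_
        rw [weight_wt]
        simp
        omega
    have := (h1.C_mul (-4)).add (h2.C_mul (-6))
    rw [serreDer_apply]
    simpa [mul_assoc, map_ofNat (MvPolynomial.C (σ := Fin 2) (R := S))] using this

/-- The Serre derivative on `q`-expansions, for polynomials of mixed weight. -/
theorem qExp_serreDer (p : MvPolynomial (Fin 2) S) : qExp S (serreDer S p) =
    12 * theta S (qExp S p) - e2Series.map (Int.castRingHom S) * qExp S (eulerDer S p) := by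
  have h4 := congrArg (PowerSeries.map (Int.castRingHom S)) theta_e4Series
  have h6 := congrArg (PowerSeries.map (Int.castRingHom S)) theta_e6Series
  simp only [map_sub, map_pow, map_mul, map_ofNat, map_theta] at h4 h6
  induction p using MvPolynomial.induction_on with
  | C a => simp [qExp, theta_apply]
  | add p q hp hq =>
    simp only [map_add, hp, hq]
    ring
  | mul_X p i hp =>
    simp only [Derivation.leibniz, map_mul, map_add, smul_eq_mul, hp]
    fin_cases i
    · simp [map_ofNat]
      linear_combination (-4 * qExp S p) * h4
    · simp [map_ofNat]
      linear_combination (-6 * qExp S p) * h6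

/-- Every monomial in `E₄`, `E₆` is `1` at the cusp. -/
theorem constantCoeff_qExp_monomial (a b : ℕ) :
    PowerSeries.constantCoeff (qExp S (MvPolynomial.X 0 ^ a * MvPolynomial.X 1 ^ b)) = 1 := by
  simp [constantCoeff_map, constantCoeff_e4Series, constantCoeff_e6Series]

end Ring

end EtaForms

/-! ### Forms of level one with integral coefficients -/

namespace EtaForms

open UpperHalfPlane Function ModularForm

section LevelOne

variable {R : Type*} [CommRing R] (j : R →+* ℂ)

/-- Every isobaric polynomial in `E₄`, `E₆` is a modular form. -/
theorem exists_modularForm_of_polynomial {w : ℕ} {p : MvPolynomial (Fin 2) R}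
    (hp : p.IsWeightedHomogeneous wt w) :
    ∃ M : ModularForm 𝒮ℒ (w : ℤ), HasQExp 1 M ((qExp R p).map j) := by
  induction hp using MvPolynomial.IsWeightedHomogeneous.induction_on with
  | zero => exact ⟨0, by simpa using! HasQExp.const 1 0⟩
  | add p q _ _ hp hq =>
    obtain ⟨M, hM⟩ := hp
    obtain ⟨N, hN⟩ := hq
    exact ⟨M + N, by simpa using hM.add hN⟩
  | monomial d r hd =>
    rw [weight_wt] at hd
    refine ⟨j r • ((E₄.pow (d 0)).mul (E₆.pow (d 1))).mcast (by push_cast [← hd]; ring), ?_⟩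
    have h := ((hasQExp_E4.pow (d 0)).mul (hasQExp_E6.pow (d 1))).smul (j r)
    convert! h using 1
    · simp only [FunLike.coe_smul, coe_mcast, ← coe_pow]
      rfl
    · rw [map_qExp, MvPolynomial.map_monomial, MvPolynomial.monomial_eq, Finsupp.prod_fintype _ _
        (by simp), Fin.prod_univ_two, ← MvPolynomial.algebraMap_eq, ← Algebra.smul_def, map_smul]
      simp

variable {j}

theorem HasQExp.eq_zero (hj : Injective j) {F : R⟦X⟧} (h : HasQExp 1 0 (F.map j)) : F = 0 := by
  have h0 : F.map j = 0 := h.unique one_pos (by simpa using! HasQExp.const 1 0)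
  ext n
  have := congrArg (PowerSeries.coeff n) h0
  rw [PowerSeries.coeff_map, map_zero, map_eq_zero_iff _ hj] at this
  simpa using this

theorem exists_weight_eq {w : ℕ} (hw : Even w) (hw4 : 4 ≤ w) : ∃ a b, 4 * a + 6 * b = w := by
  obtain ⟨m, rfl⟩ := hw
  rcases Nat.even_or_odd m with ⟨n, rfl⟩ | ⟨n, rfl⟩
  · exact ⟨n, 0, by omega⟩
  · exact ⟨n - 1, 1, by omega⟩

/-- A level one form with coefficients in a ring containing `1/1728` is a polynomial in `E₄`, `E₆`
over that ring: subtract a multiple of `E₄ᵃE₆ᵇ` to kill the constant term, divide by `Δ`, and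
induct on the weight. The division preserves the coefficient ring as `Δ = q + ⋯`. -/
theorem exists_polynomial_of_modularForm (hj : Injective j) {u : R} (hu : u * 1728 = 1) (w : ℕ)
    (f : ModularForm 𝒮ℒ (w : ℤ)) (F : R⟦X⟧) (hF : HasQExp 1 f (F.map j)) :
    ∃ p : MvPolynomial (Fin 2) R, p.IsWeightedHomogeneous wt w ∧ qExp R p = F := by
  induction w using Nat.strong_induction_on generalizing F with
  | _ w ih =>
  have hzero : f = 0 → ∃ p : MvPolynomial (Fin 2) R, p.IsWeightedHomogeneous wt w ∧
      qExp R p = F := fun h ↦ by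
    refine ⟨0, MvPolynomial.isWeightedHomogeneous_zero R wt w, ?_⟩
    rw [map_zero, HasQExp.eq_zero hj (F := F)]
    rw [h] at hF
    exact hF
  rcases Nat.even_or_odd w with hw | hw
  swap
  · exact hzero (levelOne_odd_weight_eq_zero (by exact_mod_cast hw) f)
  rcases Nat.lt_or_ge w 4 with hw4 | hw4
  · obtain rfl | rfl : w = 0 ∨ w = 2 := by
      obtain ⟨m, rfl⟩ := hw
      omega
    · obtain ⟨c, hc⟩ := ModularFormClass.levelOne_weight_zero_const f
      have h1 : F.map j = PowerSeries.C c := hF.unique one_pos (hc ▸ HasQExp.const 1 c)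
      refine ⟨MvPolynomial.C (PowerSeries.constantCoeff F),
        MvPolynomial.isWeightedHomogeneous_C wt _, ?_⟩
      have h2 : c = j (PowerSeries.constantCoeff F) := by
        rw [← constantCoeff_map, h1, PowerSeries.constantCoeff_C]
      ext n
      apply hj
      have h3 := congrArg (PowerSeries.coeff n) h1
      rw [PowerSeries.coeff_map] at h3
      rw [h3, h2, ← MvPolynomial.algebraMap_eq, AlgHom.commutes, ← PowerSeries.C_eq_algebraMap,
        PowerSeries.coeff_C, PowerSeries.coeff_C]
      split_ifs <;> simp
    · exact hzero (rank_zero_iff_forall_zero.mp levelOne_weight_two_rank_zero f)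
  obtain ⟨a, b, hab⟩ := exists_weight_eq hw hw4
  set m : MvPolynomial (Fin 2) R := MvPolynomial.C (PowerSeries.constantCoeff F) *
    (MvPolynomial.X 0 ^ a * MvPolynomial.X 1 ^ b)
  have hm : m.IsWeightedHomogeneous wt w := by
    have := (((MvPolynomial.isWeightedHomogeneous_X R wt 0).pow a).mul
      ((MvPolynomial.isWeightedHomogeneous_X R wt 1).pow b)).C_mul (PowerSeries.constantCoeff F)
    convert! this using 1
    simp [wt, ← hab, mul_comm]
  have hm0 : PowerSeries.constantCoeff (F - qExp R m) = 0 := by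
    rw [map_sub, map_mul, map_mul, constantCoeff_qExp_monomial, ← MvPolynomial.algebraMap_eq,
      AlgHom.commutes, ← PowerSeries.C_eq_algebraMap, PowerSeries.constantCoeff_C]
    simp
  obtain ⟨M, hM⟩ := exists_modularForm_of_polynomial j hm
  have hfM : HasQExp 1 (f - M : ModularForm 𝒮ℒ (w : ℤ)) ((F - qExp R m).map j) := by
    simpa using hF.sub hM
  have hqfM := (hasQExp_modularForm (f - M)).unique one_pos hfM
  have hcusp : (qExpansion 1 (f - M : ModularForm 𝒮ℒ (w : ℤ))).coeff 0 = 0 := by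
    rw [hqfM, PowerSeries.coeff_zero_eq_constantCoeff_apply, constantCoeff_map, hm0, map_zero]
  have hdiv := qExpansion_eq_qExpansion_discriminant_mul _ hcusp
  set g := CuspForm.discriminantEquiv (toCuspForm (f - M) hcusp)
  have hΔ : qExpansion 1 discriminant =
      ((PowerSeries.X * PowerSeries.pentagonalSeries R ^ 24).map j) := by
    have h1 : HasQExp 1 discriminant (qExpansion 1 discriminant) := by
      rw [← CuspForm.coe_discriminant]
      exact fun τ ↦ ModularForm.hasSum_qExpansion CuspForm.discriminant one_pos (by simp) τ
    rw [h1.unique one_pos hasQExp_discriminant]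
    simp only [map_mul, map_pow, PowerSeries.map_X, ← map_pentagonalSeries (S := R),
      ← RingHom.comp_apply, ← PowerSeries.map_comp]
    congr 4
    exact RingHom.ext_int _ _
  rcases Nat.lt_or_ge w 12 with hw12 | hw12
  · -- there is no form of negative weight, so that `f` is the monomial
    have hg : ⇑g = 0 := ModularFormClass.levelOne_neg_weight_eq_zero (by omega) g
    rw [hg, qExpansion_zero, mul_zero, hqfM] at hdiv
    refine ⟨m, hm, ?_⟩
    have : F - qExp R m = 0 := HasQExp.eq_zero hj (by
      rw [hdiv]; simpa using! HasQExp.const 1 0)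
    exact (sub_eq_zero.1 this).symm
  obtain ⟨H, hH⟩ := PowerSeries.X_dvd_iff.2 hm0
  obtain ⟨v, hv⟩ : ∃ v, PowerSeries.pentagonalSeries R ^ 24 * v = 1 := by
    refine IsUnit.exists_right_inv ?_
    simp [PowerSeries.isUnit_iff_constantCoeff, constantCoeff_pentagonalSeries]
  have hHv : F - qExp R m = PowerSeries.X * PowerSeries.pentagonalSeries R ^ 24 * (H * v) := by
    rw [hH]
    linear_combination (-PowerSeries.X * H) * hv
  have hg : (H * v).map j = qExpansion 1 g := by
    rw [hqfM, hHv, hΔ, map_mul] at hdiv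
    refine mul_left_cancel₀ ?_ hdiv
    rw [← hΔ]
    intro h
    have := discriminant_qExpansion_coeff_one
    simp [h] at this
  have hw' : ((w : ℤ) - 12) = ((w - 12 : ℕ) : ℤ) := by omega
  obtain ⟨p, hp, hpF⟩ := ih (w - 12) (by omega) (g.mcast hw') (H * v) (by
    rw [hg]
    exact hasQExp_modularForm g)
  refine ⟨m + MvPolynomial.C u * (disc R * p), hm.add (MvPolynomial.IsWeightedHomogeneous.C_mul
    ?_ u), ?_⟩
  · convert! isWeightedHomogeneous_disc.mul hp using 1
    omega
  · rw [map_add, map_mul (qExp R) (MvPolynomial.C u), map_mul (qExp R) (disc R), hpF, qExp_disc,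
      ← MvPolynomial.algebraMap_eq, AlgHom.commutes, ← PowerSeries.C_eq_algebraMap]
    have hu' : PowerSeries.C u * 1728 = 1 := by
      rw [← map_ofNat (PowerSeries.C (R := R)) 1728, ← map_mul, hu, map_one]
    linear_combination (PowerSeries.X * PowerSeries.pentagonalSeries R ^ 24 * (H * v)) * hu' - hHv

end LevelOne

end EtaForms

/-! ### Isobaric polynomials over a field and the discriminant -/

namespace EtaForms

open Function

section MvPolynomial

variable {σ : Type*} {k : Type*} [Field k]

/-- The quotient of isobaric polynomials is isobaric, whenever it is a polynomial. -/
theorem IsWeightedHomogeneous.exists_quotient {wt : σ → ℕ} {m w : ℕ} {a b : MvPolynomial σ k}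
    (ha : a.IsWeightedHomogeneous wt m) (hb : b.IsWeightedHomogeneous wt w) (hb0 : b ≠ 0)
    (hab : a ∣ b) : ∃ c n, b = a * c ∧ c.IsWeightedHomogeneous wt n ∧ m + n = w := by
  obtain ⟨c, rfl⟩ := hab
  let := MvPolynomial.weightedGradedAlgebra k wt
  have h := DirectSum.coe_decompose_mul_of_left_mem
    (𝒜 := MvPolynomial.weightedHomogeneousSubmodule k wt) w (b := c) ha
  rw [DirectSum.decompose_of_mem_same _ hb] at h
  split_ifs at h with hmw
  · exact ⟨_, w - m, h,
      (DirectSum.decompose (MvPolynomial.weightedHomogeneousSubmodule k wt) c (w - m)).2, by omega⟩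
  · exact absurd h hb0

theorem totalDegree_pderiv_lt {p : MvPolynomial σ k} {i : σ} (h : MvPolynomial.pderiv i p ≠ 0) :
    (MvPolynomial.pderiv i p).totalDegree < p.totalDegree := by
  have key : ∀ m ∈ (MvPolynomial.pderiv i p).support, m.degree + 1 ≤ p.totalDegree := by
    intro m hm
    rw [MvPolynomial.mem_support_iff, MvPolynomial.coeff_pderiv] at hm
    have := MvPolynomial.le_totalDegree (p := p) (s := m + Finsupp.single i 1)
      (MvPolynomial.mem_support_iff.2 (left_ne_zero_of_mul hm))
    change Finsupp.degree _ ≤ _ at this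
    simpa using this
  obtain ⟨m, hm⟩ := MvPolynomial.support_nonempty.2 h
  refine (Finset.sup_lt_iff ?_).2 fun m hm ↦ key m hm
  have := key m hm
  rw [bot_eq_zero]
  omega

theorem pderiv_eq_zero_of_dvd {p : MvPolynomial σ k} {i : σ}
    (h : p ∣ MvPolynomial.pderiv i p) : MvPolynomial.pderiv i p = 0 := by
  by_contra h0
  exact (totalDegree_pderiv_lt h0).not_ge (MvPolynomial.totalDegree_le_of_dvd_of_isDomain h h0)

/-- If the partial derivative in a variable vanishes, then all exponents of that variable are zero
in the field, that is, divisible by its characteristic. -/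
theorem cast_eq_zero_of_pderiv_eq_zero {p : MvPolynomial σ k} {i : σ}
    (h : MvPolynomial.pderiv i p = 0) {d : σ →₀ ℕ} (hd : p.coeff d ≠ 0) : (d i : k) = 0 := by
  rcases Nat.eq_zero_or_pos (d i) with h0 | h0
  · simp [h0]
  · have hs : d - Finsupp.single i 1 + Finsupp.single i 1 = d :=
      tsub_add_cancel_of_le (Finsupp.single_le_iff.2 h0)
    have := MvPolynomial.coeff_pderiv (i := i) p (d - Finsupp.single i 1)
    rw [h, hs, MvPolynomial.coeff_zero, eq_comm, mul_eq_zero, or_iff_right hd] at this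
    rw [← this]
    have h1 : d i = (d - Finsupp.single i 1 : σ →₀ ℕ) i + 1 := by
      simp
      omega
    conv_lhs => rw [h1]
    push_cast
    rfl

end MvPolynomial

section Cusp

variable {k : Type*} [Field k]

/-- A polynomial vanishing on the cuspidal cubic `(t², t³)` is divisible by `E₄³ - E₆²`. -/
theorem disc_dvd_of_aeval_eq_zero {p : MvPolynomial (Fin 2) k}
    (h : MvPolynomial.aeval ![(Polynomial.X ^ 2 : Polynomial k), Polynomial.X ^ 3] p = 0) :
    disc k ∣ p := by
  -- modulo the discriminant, `p` is at most linear in `E₆`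
  have key : ∀ p : MvPolynomial (Fin 2) k, ∃ α β : Polynomial k, disc k ∣ p -
      (Polynomial.aeval (MvPolynomial.X 0) α +
        Polynomial.aeval (MvPolynomial.X 0) β * MvPolynomial.X 1) := by
    intro p
    induction p using MvPolynomial.induction_on with
    | C a => exact ⟨Polynomial.C a, 0, by simp [MvPolynomial.algebraMap_eq]⟩
    | add p q hp hq =>
      obtain ⟨α, β, c, hp⟩ := hp
      obtain ⟨α', β', c', hq⟩ := hq
      refine ⟨α + α', β + β', c + c', ?_⟩
      simp only [map_add]
      linear_combination hp + hq
    | mul_X p i hp =>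
      obtain ⟨α, β, c, hp⟩ := hp
      fin_cases i
      · refine ⟨α * Polynomial.X, β * Polynomial.X, c * MvPolynomial.X 0, ?_⟩
        simp only [map_mul, Polynomial.aeval_X, Fin.zero_eta]
        linear_combination MvPolynomial.X 0 * hp
      · refine ⟨β * Polynomial.X ^ 3, α, c * MvPolynomial.X 1 -
          Polynomial.aeval (MvPolynomial.X 0) β, ?_⟩
        simp only [map_mul, map_pow, Polynomial.aeval_X, Fin.mk_one, disc] at hp ⊢
        linear_combination MvPolynomial.X 1 * hp
  obtain ⟨α, β, c, hc⟩ := key p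
  have hα : MvPolynomial.aeval ![(Polynomial.X ^ 2 : Polynomial k), Polynomial.X ^ 3]
      (Polynomial.aeval (MvPolynomial.X (R := k) (0 : Fin 2)) α) = Polynomial.expand k 2 α := by
    rw [← Polynomial.aeval_algHom_apply, MvPolynomial.aeval_X]
    rfl
  have hβ : MvPolynomial.aeval ![(Polynomial.X ^ 2 : Polynomial k), Polynomial.X ^ 3]
      (Polynomial.aeval (MvPolynomial.X (R := k) (0 : Fin 2)) β) = Polynomial.expand k 2 β := by
    rw [← Polynomial.aeval_algHom_apply, MvPolynomial.aeval_X]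
    rfl
  have h0 := congrArg
    (MvPolynomial.aeval ![(Polynomial.X ^ 2 : Polynomial k), Polynomial.X ^ 3]) hc
  have hd : MvPolynomial.aeval ![(Polynomial.X ^ 2 : Polynomial k), Polynomial.X ^ 3]
      (disc k) = 0 := by
    simp [disc]
    ring
  rw [map_sub, h, map_add, map_mul, map_mul, hα, hβ, hd, zero_mul, MvPolynomial.aeval_X] at h0
  simp only [Matrix.cons_val_one, Matrix.cons_val_fin_one] at h0
  -- the even and the odd part vanish separately
  have hα0 : α = 0 := by
    ext n
    have := congrArg (Polynomial.coeff · (2 * n)) h0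
    simp only [Polynomial.coeff_sub, Polynomial.coeff_add, Polynomial.coeff_zero,
      Polynomial.coeff_expand two_pos, Polynomial.coeff_mul_X_pow'] at this
    rw [if_pos (dvd_mul_right 2 n), Nat.mul_div_cancel_left _ two_pos] at this
    split_ifs at this with h1 h2
    · omega
    all_goals simpa using this
  have hβ0 : β = 0 := by
    ext n
    have := congrArg (Polynomial.coeff · (2 * n + 3)) h0
    simp only [hα0, map_zero, Polynomial.coeff_sub, Polynomial.coeff_add, Polynomial.coeff_zero,
      Polynomial.coeff_expand two_pos, Polynomial.coeff_mul_X_pow] at this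
    simpa using this
  exact ⟨c, by simpa [hα0, hβ0] using hc⟩

/-- On the cuspidal cubic an isobaric polynomial is determined by its value at the cusp. -/
theorem aeval_cusp_eq {p : MvPolynomial (Fin 2) k} {w : ℕ} (hp : p.IsWeightedHomogeneous wt w) :
    MvPolynomial.aeval ![(Polynomial.X ^ 2 : Polynomial k), Polynomial.X ^ 3] p =
      Polynomial.C (PowerSeries.constantCoeff (qExp k p)) * Polynomial.X ^ (w / 2) := by
  induction hp using MvPolynomial.IsWeightedHomogeneous.induction_on with
  | zero => simp
  | add p q _ _ hp hq => simp only [map_add, hp, hq]; ring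
  | monomial d r hd =>
    rw [weight_wt] at hd
    rw [MvPolynomial.monomial_eq, Finsupp.prod_fintype _ _ (by simp), Fin.prod_univ_two,
      map_mul (qExp k), map_mul PowerSeries.constantCoeff, constantCoeff_qExp_monomial,
      ← MvPolynomial.algebraMap_eq, AlgHom.commutes, ← PowerSeries.C_eq_algebraMap,
      PowerSeries.constantCoeff_C, map_mul, AlgHom.commutes,
      show w / 2 = 2 * d 0 + 3 * d 1 by omega]
    simp [pow_add, pow_mul, Polynomial.algebraMap_eq]

/-- A form vanishing at the cusp is divisible by `Δ`. -/
theorem disc_dvd_of_constantCoeff_eq_zero {p : MvPolynomial (Fin 2) k} {w : ℕ}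
    (hp : p.IsWeightedHomogeneous wt w) (h : PowerSeries.constantCoeff (qExp k p) = 0) :
    disc k ∣ p :=
  disc_dvd_of_aeval_eq_zero (by rw [aeval_cusp_eq hp, h, map_zero, zero_mul])

theorem disc_ne_zero : disc k ≠ 0 := by
  intro h
  have := congrArg (MvPolynomial.aeval ![(1 : k), 0]) h
  simp [disc] at this

theorem qExp_disc_ne_zero (h : (1728 : k) ≠ 0) : qExp k (disc k) ≠ 0 := by
  rw [qExp_disc]
  refine mul_ne_zero ?_ (mul_ne_zero PowerSeries.X_ne_zero (pow_ne_zero _ ?_))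
  · rw [← map_ofNat (PowerSeries.C (R := k)) 1728]
    simpa using h
  · intro h0
    have := constantCoeff_pentagonalSeries (S := k)
    simp [h0] at this

/-- An isobaric polynomial is determined by its `q`-expansion. -/
theorem eq_zero_of_qExp_eq_zero (h1728 : (1728 : k) ≠ 0) {p : MvPolynomial (Fin 2) k} {w : ℕ}
    (hp : p.IsWeightedHomogeneous wt w) (h : qExp k p = 0) : p = 0 := by
  induction w using Nat.strong_induction_on generalizing p with
  | _ w ih =>
  by_contra hp0
  obtain ⟨c, n, hc, hcn, hn⟩ := IsWeightedHomogeneous.exists_quotient isWeightedHomogeneous_disc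
    hp hp0 (disc_dvd_of_constantCoeff_eq_zero hp (by simp [h]))
  rw [hc, map_mul, mul_eq_zero, or_iff_right (qExp_disc_ne_zero h1728)] at h
  exact hp0 (by rw [hc, ih n (by omega) hcn h, mul_zero])

theorem eq_of_qExp_eq (h1728 : (1728 : k) ≠ 0) {p q : MvPolynomial (Fin 2) k} {w : ℕ}
    (hp : p.IsWeightedHomogeneous wt w) (hq : q.IsWeightedHomogeneous wt w)
    (h : qExp k p = qExp k q) : p = q :=
  sub_eq_zero.1 (eq_zero_of_qExp_eq_zero h1728 (hp.sub hq) (by rw [map_sub, h, sub_self]))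

end Cusp

end EtaForms

/-! ### The Hasse invariant and forms annihilated by `q d/dq` -/

namespace EtaForms

open Function

section Hasse

variable {k : Type*} [Field k] {ℓ : ℕ} [CharP k ℓ]

theorem natCast_ne_zero_of_lt {n : ℕ} (h0 : 0 < n) (hn : n < ℓ) : (n : k) ≠ 0 := by
  rw [Ne, CharP.cast_eq_zero_iff k ℓ]
  exact fun h ↦ hn.not_ge (Nat.le_of_dvd h0 h)

variable (hℓ : ℓ.Prime) (hℓ5 : 5 ≤ ℓ) {A : MvPolynomial (Fin 2) k}
  (hA : A.IsWeightedHomogeneous wt (ℓ - 1)) (hA1 : qExp k A = 1)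

include hℓ5

theorem two_ne_zero_of_charP : (2 : k) ≠ 0 :=
  mod_cast natCast_ne_zero_of_lt (k := k) (ℓ := ℓ) (n := 2) (by omega) (by omega)

theorem three_ne_zero_of_charP : (3 : k) ≠ 0 :=
  mod_cast natCast_ne_zero_of_lt (k := k) (ℓ := ℓ) (n := 3) (by omega) (by omega)

theorem ne_zero_1728_of_charP : (1728 : k) ≠ 0 := by
  have h : (1728 : k) = 2 ^ 6 * 3 ^ 3 := by norm_num
  rw [h]
  exact mul_ne_zero (pow_ne_zero _ (two_ne_zero_of_charP hℓ5))
    (pow_ne_zero _ (three_ne_zero_of_charP hℓ5))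

include hℓ hA

omit hℓ5 in
theorem eulerDer_hasse : eulerDer k A = -A := by
  rw [eulerDer_of_isWeightedHomogeneous hA, Nat.cast_sub hℓ.one_le,
    ← map_natCast (MvPolynomial.C (R := k) (σ := Fin 2)) ℓ, CharP.cast_eq_zero k ℓ]
  simp

include hA1

/-- The differential equation of the Hasse invariant: `∂A` has `q`-expansion `E₂`, and
`12 θ E₂ = E₂² - E₄`. -/
theorem serreDer_serreDer_hasse :
    serreDer k (serreDer k A) = -(MvPolynomial.X 0 * A) := by
  have h2 := congrArg (PowerSeries.map (Int.castRingHom k)) theta_e2Series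
  simp only [map_sub, map_pow, map_mul, map_ofNat, map_theta] at h2
  have hd := isWeightedHomogeneous_serreDer hA
  have h1 : qExp k (serreDer k A) = e2Series.map (Int.castRingHom k) := by
    rw [qExp_serreDer, eulerDer_hasse hℓ hA, map_neg, hA1]
    simp
  have he : eulerDer k (serreDer k A) = serreDer k A := by
    rw [eulerDer_of_isWeightedHomogeneous hd, show ℓ - 1 + 2 = ℓ + 1 by have := hℓ.one_le; omega]
    rw [Nat.cast_add, ← map_natCast (MvPolynomial.C (R := k) (σ := Fin 2)) ℓ,
      CharP.cast_eq_zero k ℓ]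
    simp
  refine eq_of_qExp_eq (ne_zero_1728_of_charP hℓ5)
    (isWeightedHomogeneous_serreDer hd) (w := ℓ - 1 + 2 + 2) ?_ ?_
  · refine MvPolynomial.IsWeightedHomogeneous.neg ?_
    convert! (MvPolynomial.isWeightedHomogeneous_X k wt 0).mul hA using 1
    simp only [wt, Matrix.cons_val_zero]
    omega
  · rw [qExp_serreDer, he, h1, map_neg, map_mul, hA1, qExp_X_zero]
    linear_combination h2

omit [CharP k ℓ] hℓ5 hA1 in
theorem totalDegree_hasse_lt : A.totalDegree < ℓ := by
  refine (Finset.sup_lt_iff hℓ.pos).2 fun d hd ↦ ?_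
  have := hA (MvPolynomial.mem_support_iff.1 hd)
  rw [weight_wt] at this
  rw [Finsupp.sum_fintype _ _ (by simp), Fin.sum_univ_two]
  have := hℓ.one_le
  omega

/-- The Hasse invariant has no multiple factor: such a factor would divide its own partial
derivatives or the discriminant. -/
theorem squarefree_hasse : Squarefree A := by
  have hA0 : A ≠ 0 := by
    rintro rfl
    simp at hA1
  rw [squarefree_iff_irreducible_sq_not_dvd_of_ne_zero hA0]
  intro p hp hpA
  have hfin : FiniteMultiplicity p A := FiniteMultiplicity.of_prime_left hp.prime hA0
  obtain ⟨u, hu, hpu⟩ := hfin.exists_eq_pow_mul_and_not_dvd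
  have h2 : 2 ≤ multiplicity p A := hfin.le_multiplicity_of_pow_dvd (by rwa [sq])
  obtain ⟨n, hn⟩ := Nat.exists_eq_add_of_le' h2
  rw [hn] at hu
  have hp0 : p ≠ 0 := hp.ne_zero
  have hu0 : u ≠ 0 := by
    rintro rfl
    simp at hpu
  have hpdeg : 0 < p.totalDegree := by
    refine Nat.pos_of_ne_zero fun h ↦ hp.not_isUnit ?_
    have hC := MvPolynomial.totalDegree_eq_zero_iff_eq_C.1 h
    rw [hC]
    refine IsUnit.map _ (IsUnit.mk0 _ fun h0 ↦ hp0 ?_)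
    rw [hC, h0, map_zero]
  have hpA' : p.totalDegree < ℓ := (MvPolynomial.totalDegree_le_of_dvd_of_isDomain
    ((dvd_mul_right p p).trans hpA) hA0).trans_lt (totalDegree_hasse_lt hℓ hA)
  have hnℓ : n + 2 < ℓ := by
    refine lt_of_le_of_lt ?_ (totalDegree_hasse_lt hℓ hA)
    have h1 : ∀ m, (p ^ m).totalDegree = m * p.totalDegree := by
      intro m
      induction m with
      | zero => simp
      | succ m ih =>
        rw [pow_succ, MvPolynomial.totalDegree_mul_of_isDomain (pow_ne_zero _ hp0) hp0, ih]
        ring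
    rw [hu, MvPolynomial.totalDegree_mul_of_isDomain (pow_ne_zero _ hp0) hu0, h1]
    nlinarith
  have hcast : ∀ m : ℕ, 0 < m → m < ℓ → ¬ p ∣ (m : MvPolynomial (Fin 2) k) := by
    intro m h0 hm hdvd
    refine hp.not_isUnit (isUnit_of_dvd_unit hdvd ?_)
    rw [← map_natCast (MvPolynomial.C (R := k) (σ := Fin 2))]
    exact (IsUnit.mk0 _ (natCast_ne_zero_of_lt h0 hm)).map _
  have hpow : ∀ (D : Derivation k (MvPolynomial (Fin 2) k) (MvPolynomial (Fin 2) k)) (m : ℕ)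
      (y : MvPolynomial (Fin 2) k), D (p ^ (m + 1) * y) =
        p ^ m * ((m + 1 : ℕ) * (D p * y) + p * D y) := by
    intro D m y
    rw [Derivation.leibniz, Derivation.leibniz_pow]
    simp only [smul_eq_mul, nsmul_eq_mul, Nat.add_sub_cancel]
    ring
  -- apply the derivations to `A = p ^ (n + 2) * u`, where all of `1, …, n + 2` are units
  have hE : p ∣ eulerDer k p := by
    have h := eulerDer_hasse hℓ hA
    rw [hu, hpow] at h
    have h' : p ^ (n + 1) * ((n + 1 + 1 : ℕ) * (eulerDer k p * u) + p * eulerDer k u) =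
        p ^ (n + 1) * (-(p * u)) := by rw [h]; ring
    have h3 := mul_left_cancel₀ (pow_ne_zero _ hp0) h'
    have h4 : p ∣ ((n + 1 + 1 : ℕ) : MvPolynomial (Fin 2) k) * (eulerDer k p * u) :=
      ⟨-u - eulerDer k u, by linear_combination h3⟩
    exact ((hp.prime.dvd_or_dvd ((hp.prime.dvd_or_dvd h4).resolve_left
      (hcast _ (by omega) (by omega))))).resolve_right hpu
  have hS : p ∣ serreDer k p := by
    have h := serreDer_serreDer_hasse hℓ hℓ5 hA hA1
    rw [hu, hpow, hpow] at h
    generalize serreDer k (((n + 1 + 1 : ℕ) : MvPolynomial (Fin 2) k) * (serreDer k p * u) +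
      p * serreDer k u) = Z at h
    have h3 := mul_left_cancel₀ (pow_ne_zero n hp0)
      (h.trans (show _ = p ^ n * (-(MvPolynomial.X 0 * p ^ 2 * u)) by ring))
    have h4 : p ∣ ((n + 1 : ℕ) : MvPolynomial (Fin 2) k) *
        (((n + 1 + 1 : ℕ) : MvPolynomial (Fin 2) k) *
          (serreDer k p * (serreDer k p * u))) :=
      ⟨-(MvPolynomial.X 0 * p * u) - Z -
        ((n + 1 : ℕ) : MvPolynomial (Fin 2) k) * serreDer k p * serreDer k u,
        by linear_combination h3⟩
    have h5 := (hp.prime.dvd_or_dvd ((hp.prime.dvd_or_dvd h4).resolve_left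
      (hcast _ (by omega) (by omega)))).resolve_left (hcast _ (by omega) (by omega))
    rcases hp.prime.dvd_or_dvd h5 with h6 | h6
    · exact h6
    · exact (hp.prime.dvd_or_dvd h6).resolve_right hpu
  -- otherwise the cofactor of `p` in the discriminant vanishes on the cuspidal cubic, as `A` does
  -- not, and `p` is a unit
  have hdisc : ¬ p ∣ disc k := by
    rintro ⟨s, hs⟩
    set φ := MvPolynomial.aeval (R := k) ![(Polynomial.X ^ 2 : Polynomial k), Polynomial.X ^ 3]
    have hφp : φ p ≠ 0 := by
      obtain ⟨y, hy⟩ := (dvd_mul_right p p).trans hpA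
      intro h0
      have h1 := aeval_cusp_eq hA
      change φ A = _ at h1
      rw [hA1, hy, map_mul, h0] at h1
      simp only [map_one, one_mul, zero_mul] at h1
      exact pow_ne_zero _ Polynomial.X_ne_zero h1.symm
    have hφd : φ (disc k) = 0 := by
      simp [disc, φ]
      ring
    rw [hs, map_mul, mul_eq_zero, or_iff_right hφp] at hφd
    obtain ⟨y, hy⟩ := disc_dvd_of_aeval_eq_zero hφd
    refine hp.not_isUnit (IsUnit.of_mul_eq_one y (mul_left_cancel₀ (disc_ne_zero (k := k)) ?_))
    linear_combination -hs - p * hy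
  have h4 : ¬ p ∣ 4 := mod_cast hcast 4 (by omega) (by omega)
  have h6 : ¬ p ∣ 6 := by
    intro h
    have h' : p ∣ ((2 : ℕ) : MvPolynomial (Fin 2) k) * ((3 : ℕ) : MvPolynomial (Fin 2) k) := by
      norm_num [h]
    rcases hp.prime.dvd_or_dvd h' with h | h
    · exact hcast 2 (by omega) (by omega) h
    · exact hcast 3 (by omega) (by omega) h
  -- the determinant of the two derivations in terms of the partial ones is `24` times `disc`
  have hpd0 : MvPolynomial.pderiv 0 p = 0 := by
    refine pderiv_eq_zero_of_dvd ?_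
    have : p ∣ 4 * (disc k * MvPolynomial.pderiv 0 p) := by
      have := dvd_add (hS.mul_left (MvPolynomial.X 1)) (hE.mul_left (MvPolynomial.X 0 ^ 2))
      rw [serreDer_apply, eulerDer_apply] at this
      convert! this using 1
      rw [disc]
      ring
    exact (hp.prime.dvd_or_dvd ((hp.prime.dvd_or_dvd this).resolve_left h4)).resolve_left hdisc
  have hpd1 : MvPolynomial.pderiv 1 p = 0 := by
    refine pderiv_eq_zero_of_dvd ?_
    have : p ∣ 6 * (disc k * MvPolynomial.pderiv 1 p) := by
      have := dvd_neg.2 (dvd_add (hS.mul_left (MvPolynomial.X 0)) (hE.mul_left (MvPolynomial.X 1)))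
      rw [serreDer_apply, eulerDer_apply] at this
      convert! this using 1
      rw [disc]
      ring
    exact (hp.prime.dvd_or_dvd ((hp.prime.dvd_or_dvd this).resolve_left h6)).resolve_left hdisc
  -- the exponents are smaller than `ℓ`, so that `p` is constant
  refine hpdeg.ne' (Nat.eq_zero_of_le_zero (Finset.sup_le fun d hd ↦ ?_))
  have hdp := MvPolynomial.le_totalDegree hd
  rw [Finsupp.sum_fintype _ _ (by simp), Fin.sum_univ_two] at hdp ⊢
  have hd' := MvPolynomial.mem_support_iff.1 hd
  have e0 := cast_eq_zero_of_pderiv_eq_zero hpd0 hd'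
  have e1 := cast_eq_zero_of_pderiv_eq_zero hpd1 hd'
  rw [CharP.cast_eq_zero_iff k ℓ] at e0 e1
  have f0 := Nat.eq_zero_of_dvd_of_lt e0 (by omega)
  have f1 := Nat.eq_zero_of_dvd_of_lt e1 (by omega)
  omega

end Hasse

section Root

variable {k : Type*} [Field k] {ℓ : ℕ} [CharP k ℓ]

/-- Over a perfect field of characteristic `ℓ`, an isobaric polynomial with vanishing partial
derivatives is the `ℓ`-th power of an isobaric polynomial. -/
theorem exists_pow_eq_of_pderiv_eq_zero (hℓ : ℓ.Prime) (hk : Surjective (fun x : k ↦ x ^ ℓ))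
    {B : MvPolynomial (Fin 2) k} {w : ℕ} (hB : B.IsWeightedHomogeneous wt (ℓ * w))
    (h : ∀ i, MvPolynomial.pderiv i B = 0) :
    ∃ H : MvPolynomial (Fin 2) k, H.IsWeightedHomogeneous wt w ∧ H ^ ℓ = B := by
  have : Fact ℓ.Prime := ⟨hℓ⟩
  choose root hroot using hk
  have hdvd : ∀ d ∈ B.support, ∃ e : Fin 2 →₀ ℕ, d = ℓ • e := by
    intro d hd
    have h0 (i : Fin 2) : ℓ ∣ d i := by
      rw [← CharP.cast_eq_zero_iff k ℓ]
      exact cast_eq_zero_of_pderiv_eq_zero (h i) (MvPolynomial.mem_support_iff.1 hd)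
    refine ⟨d.mapRange (· / ℓ) (by simp), ?_⟩
    ext i
    simp [Nat.mul_div_cancel' (h0 i)]
  choose! e he using hdvd
  refine ⟨∑ d ∈ B.support, MvPolynomial.monomial (e d) (root (B.coeff d)),
    MvPolynomial.IsWeightedHomogeneous.sum _ _ _ fun d hd ↦
      MvPolynomial.isWeightedHomogeneous_monomial _ _ _ ?_, ?_⟩
  · have := hB (MvPolynomial.mem_support_iff.1 hd)
    rw [he d hd, map_nsmul, smul_eq_mul] at this
    exact Nat.eq_of_mul_eq_mul_left hℓ.pos this
  · rw [sum_pow_char ℓ]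
    conv_rhs => rw [B.as_sum]
    refine Finset.sum_congr rfl fun d hd ↦ ?_
    rw [MvPolynomial.monomial_pow, ← he d hd]
    congr 1
    exact hroot _

/-- A mod `ℓ` form of weight `W` annihilated by `θ` has the `q`-expansion of the `ℓ`-th power of
a form of weight at most `W / ℓ`. -/
theorem exists_pow_of_theta_eq_zero (hℓ : ℓ.Prime) (hℓ5 : 5 ≤ ℓ)
    (hk : Surjective (fun x : k ↦ x ^ ℓ)) {A : MvPolynomial (Fin 2) k}
    (hA : A.IsWeightedHomogeneous wt (ℓ - 1)) (hA1 : qExp k A = 1)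
    {P : MvPolynomial (Fin 2) k} {W : ℕ} (hP : P.IsWeightedHomogeneous wt W) (hP0 : P ≠ 0)
    (hθ : theta k (qExp k P) = 0) :
    ∃ (w : ℕ) (H : MvPolynomial (Fin 2) k), H.IsWeightedHomogeneous wt w ∧ ℓ * w ≤ W ∧
      qExp k H ^ ℓ = qExp k P := by
  have h1728 := ne_zero_1728_of_charP (k := k) hℓ5
  obtain ⟨m, rfl⟩ : ∃ m, ℓ = m + 1 := ⟨ℓ - 1, by omega⟩
  rw [Nat.add_sub_cancel] at hA
  -- divide by the Hasse invariant as long as the weight is too large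
  have descent : ∀ (j n : ℕ) (H : MvPolynomial (Fin 2) k), H.IsWeightedHomogeneous wt n →
      (m + 1) * n = W + j * m → qExp k H ^ (m + 1) = qExp k P →
      ∃ (w : ℕ) (H : MvPolynomial (Fin 2) k), H.IsWeightedHomogeneous wt w ∧ (m + 1) * w ≤ W ∧
        qExp k H ^ (m + 1) = qExp k P := by
    intro j
    induction j using Nat.strong_induction_on with
    | _ j ih =>
    intro n H hH hn hHP
    rcases Nat.eq_zero_or_pos j with rfl | hj
    · exact ⟨n, H, hH, by omega, hHP⟩
    have hpow : H ^ (m + 1) = P * A ^ j := by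
      refine eq_of_qExp_eq h1728 (w := (m + 1) * n) (by simpa using hH.pow (m + 1)) ?_ ?_
      · rw [hn]
        simpa using hP.mul (hA.pow j)
      · rw [map_pow, map_mul, map_pow, hA1, hHP, one_pow, mul_one]
    have hH0 : H ≠ 0 := by
      rintro rfl
      have h0 : qExp k P = 0 := by rw [← hHP]; simp
      exact hP0 (eq_zero_of_qExp_eq_zero h1728 hP h0)
    have hAH : A ∣ H := by
      refine ((squarefree_hasse hℓ hℓ5 (by simpa using hA) hA1).dvd_pow_iff_dvd
        (Nat.succ_ne_zero m)).1 ?_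
      rw [hpow]
      exact (dvd_pow_self A hj.ne').mul_left P
    obtain ⟨c, n', rfl, hc, rfl⟩ := IsWeightedHomogeneous.exists_quotient hA hH hH0 hAH
    have hcP : qExp k c ^ (m + 1) = qExp k P := by
      rw [← hHP, map_mul, hA1, one_mul]
    rcases Nat.lt_or_ge j (m + 1) with hjm | hjm
    · refine ⟨n', c, hc, ?_, hcP⟩
      have : j * m ≤ (m + 1) * m := Nat.mul_le_mul_right m hjm.le
      linarith
    · refine ih (j - (m + 1)) (by omega) n' c hc ?_ hcP
      obtain ⟨i, rfl⟩ := Nat.exists_eq_add_of_le hjm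
      rw [Nat.add_sub_cancel_left]
      linarith
  -- multiplied by a power of `A` to make the weight divisible by `ℓ`, `P` is an `ℓ`-th power
  set B := P * A ^ W
  have hB : B.IsWeightedHomogeneous wt ((m + 1) * W) := by
    convert! hP.mul (hA.pow W) using 1
    rw [smul_eq_mul]
    ring
  have hBP : qExp k B = qExp k P := by rw [map_mul, map_pow, hA1, one_pow, mul_one]
  have hE : eulerDer k B = 0 := by
    rw [eulerDer_of_isWeightedHomogeneous hB,
      ← map_natCast (MvPolynomial.C (R := k) (σ := Fin 2)), Nat.cast_mul,
      CharP.cast_eq_zero k (m + 1)]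
    simp
  have hS : serreDer k B = 0 := by
    refine eq_zero_of_qExp_eq_zero h1728 (isWeightedHomogeneous_serreDer hB) ?_
    rw [qExp_serreDer, hE, hBP, hθ]
    simp
  have h4 : (4 : MvPolynomial (Fin 2) k) ≠ 0 := by
    have : (4 : k) ≠ 0 := by
      simpa using natCast_ne_zero_of_lt (k := k) (ℓ := m + 1) (n := 4) (by omega) (by omega)
    rw [← map_ofNat (MvPolynomial.C (R := k) (σ := Fin 2))]
    simpa using this
  have h6 : (6 : MvPolynomial (Fin 2) k) ≠ 0 := by
    have : (6 : k) ≠ 0 := by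
      rw [show (6 : k) = 2 * 3 by norm_num]
      exact mul_ne_zero (two_ne_zero_of_charP hℓ5) (three_ne_zero_of_charP hℓ5)
    rw [← map_ofNat (MvPolynomial.C (R := k) (σ := Fin 2))]
    simpa using this
  rw [eulerDer_apply] at hE
  rw [serreDer_apply] at hS
  have hpd0 : MvPolynomial.pderiv 0 B = 0 := by
    have : 4 * (disc k * MvPolynomial.pderiv 0 B) = 0 := by
      rw [disc]
      linear_combination MvPolynomial.X 1 * hS + MvPolynomial.X 0 ^ 2 * hE
    simpa [h4, disc_ne_zero] using this
  have hpd1 : MvPolynomial.pderiv 1 B = 0 := by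
    have : 6 * (disc k * MvPolynomial.pderiv 1 B) = 0 := by
      rw [disc]
      linear_combination - MvPolynomial.X 0 * hS - MvPolynomial.X 1 * hE
    simpa [h6, disc_ne_zero] using this
  obtain ⟨H, hH, hHB⟩ := exists_pow_eq_of_pderiv_eq_zero hℓ hk hB (fun i ↦ by
    fin_cases i
    · exact hpd0
    · exact hpd1)
  exact descent W W H hH (by ring) (by rw [← map_pow, hHB, hBP])

end Root

end EtaForms

/-! ### The residue field of `v` and the reduction of `E_{ℓ-1}` -/

namespace EtaForms

open Function IsDedekindDomain
open scoped ArithmeticFunction.sigma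

theorem isWeightedHomogeneous_map {τ R S : Type*} [CommSemiring R] [CommSemiring S] (j : R →+* S)
    {wt : τ → ℕ} {w : ℕ} {p : MvPolynomial τ R} (hp : p.IsWeightedHomogeneous wt w) :
    (p.map j).IsWeightedHomogeneous wt w := fun d hd ↦ hp fun h ↦ hd (by
  rw [MvPolynomial.coeff_map, h, map_zero])

section Integers

variable {K : Type*} [Field K] [NumberField K] (v : HeightOneSpectrum (𝓞 K))

/-- The ring of `v`-integral elements of `K`. -/
noncomputable abbrev Ov : ValuationSubring K := (v.valuation K).valuationSubring

/-- The residue field of `v`. -/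
noncomputable abbrev ResField : Type _ := IsLocalRing.ResidueField (Ov v)

theorem residue_eq_zero_iff (x : Ov v) :
    IsLocalRing.residue (Ov v) x = 0 ↔ v.valuation K (x : K) < 1 := by
  rw [IsLocalRing.residue_eq_zero_iff, Valuation.mem_maximalIdeal_iff]

theorem finite_resField : Finite (ResField v) := by
  have : Finite (𝓞 K ⧸ v.asIdeal) := v.asIdeal.finiteQuotientOfFreeOfNeBot v.ne_bot
  let φ : 𝓞 K →+* ResField v := (IsLocalRing.residue (Ov v)).comp
    ((algebraMap (𝓞 K) K).codRestrict (Ov v).toSubring fun x ↦ v.valuation_le_one x)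
  have hφ : ∀ a ∈ v.asIdeal, φ a = 0 := fun a ha ↦
    (residue_eq_zero_iff v _).2 ((v.valuation_lt_one_iff_mem (K := K) a).2 ha)
  refine Finite.of_surjective (Ideal.Quotient.lift v.asIdeal φ hφ)
    (Ideal.Quotient.lift_surjective_of_surjective _ hφ fun y ↦ ?_)
  obtain ⟨x, rfl⟩ := IsLocalRing.residue_surjective y
  obtain ⟨a, ha⟩ := v.exists_valuation_sub_lt_of_integer x.2 1
  refine ⟨a, ?_⟩
  rw [← sub_eq_zero]
  change IsLocalRing.residue (Ov v) _ - _ = 0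
  rw [← map_sub, residue_eq_zero_iff]
  exact ha

variable {v} {ℓ : ℕ} (hℓ : ℓ.Prime) (hv : (ℓ : 𝓞 K) ∈ v.asIdeal)

include hv in
theorem valuation_natCast_lt_one : v.valuation K (ℓ : K) < 1 := by
  simpa using (v.valuation_lt_one_iff_mem (K := K) (ℓ : 𝓞 K)).2 hv

include hℓ hv

theorem charP_resField : CharP (ResField v) ℓ := by
  rw [CharP.charP_iff_prime_eq_zero hℓ, ← map_natCast (IsLocalRing.residue (Ov v)),
    residue_eq_zero_iff]
  simpa using valuation_natCast_lt_one hv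

theorem surjective_pow : Surjective fun x : ResField v ↦ x ^ ℓ := by
  have := finite_resField v
  have := charP_resField hℓ hv
  have : Fact ℓ.Prime := ⟨hℓ⟩
  exact Finite.surjective_of_injective (frobenius_inj (ResField v) ℓ)

theorem valuation_natCast_eq_one {m : ℕ} (hm : ¬ ℓ ∣ m) : v.valuation K (m : K) = 1 := by
  have := charP_resField hℓ hv
  rw [← CharP.cast_eq_zero_iff (ResField v) ℓ, ← map_natCast (IsLocalRing.residue (Ov v)),
    residue_eq_zero_iff] at hm
  refine le_antisymm ((m : Ov v).2) (le_of_not_gt ?_)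
  simpa using hm

theorem exists_mul_1728_eq_one (hℓ5 : 5 ≤ ℓ) : ∃ u : Ov v, u * 1728 = 1 := by
  have := charP_resField hℓ hv
  refine IsUnit.exists_left_inv ?_
  rw [← not_not (a := IsUnit _), ← mem_nonunits_iff, ← IsLocalRing.mem_maximalIdeal,
    ← IsLocalRing.residue_eq_zero_iff, map_ofNat]
  exact ne_zero_1728_of_charP (k := ResField v) hℓ5

/-- By von Staudt and Clausen, `E_{ℓ-1} ≡ 1` modulo `ℓ`. -/
theorem valuation_eisenstein_coeff_lt_one (hℓ5 : 5 ≤ ℓ) :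
    v.valuation K ((-(2 * (ℓ - 1 : ℕ) / bernoulli (ℓ - 1)) : ℚ) : K) < 1 := by
  have hint (n : ℤ) : v.valuation K (n : K) ≤ 1 := (n : Ov v).2
  obtain ⟨m, hm⟩ : ∃ m, ℓ - 1 = 2 * m := by
    obtain ⟨m, hm⟩ := hℓ.odd_of_ne_two (by omega)
    exact ⟨m, by omega⟩
  obtain ⟨n, hn⟩ := Bernoulli.vonStaudt_clausen m
  set s := {p ∈ Finset.range (2 * m + 2) | p.Prime ∧ (p - 1) ∣ 2 * m} with hs
  have hℓs : ℓ ∈ s := by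
    simp only [hs, Finset.mem_filter, Finset.mem_range]
    exact ⟨by omega, hℓ, hm ▸ dvd_rfl⟩
  have hℓ0 : (ℓ : ℚ) ≠ 0 := mod_cast hℓ.ne_zero
  rw [← Finset.add_sum_erase s _ hℓs, ← hm] at hn
  set y : ℚ := n - ∑ p ∈ s.erase ℓ, 1 / (p : ℚ) with hy
  have hyB : ℓ * bernoulli (ℓ - 1) = -1 + ℓ * y := by
    rw [hy, hn]
    field_simp
    ring
  have hy1 : v.valuation K (y : K) ≤ 1 := by
    rw [hy, Rat.cast_sub, Rat.cast_intCast, Rat.cast_sum]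
    refine (Valuation.map_sub_le _ (hint n) (Valuation.map_sum_le _ fun p hp ↦ ?_))
    have hp' := Finset.mem_erase.1 hp
    have hpp : p.Prime := by
      have := hp'.2
      simp only [hs, Finset.mem_filter] at this
      exact this.2.1
    simp [valuation_natCast_eq_one hℓ hv (m := p)
      (fun h ↦ hp'.1 ((Nat.prime_dvd_prime_iff_eq hℓ hpp).1 h).symm)]
  have hB : v.valuation K ((ℓ * bernoulli (ℓ - 1) : ℚ) : K) = 1 := by
    rw [hyB, Rat.cast_add, Valuation.map_add_eq_of_lt_left]
    · simp
    · rw [Rat.cast_mul, map_mul, Rat.cast_natCast, Rat.cast_neg, Valuation.map_neg]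
      simpa using mul_lt_one_of_lt_of_le (valuation_natCast_lt_one hv) hy1
  have hB0 : bernoulli (ℓ - 1) ≠ 0 := by
    intro h
    simp [h] at hB
  have hc : (-(2 * (ℓ - 1 : ℕ) / bernoulli (ℓ - 1)) : ℚ) * (ℓ * bernoulli (ℓ - 1)) =
      ((-(2 * (ℓ - 1 : ℕ)) : ℤ) : ℚ) * ℓ := by
    push_cast
    field_simp
  have h := congrArg (fun x : ℚ ↦ v.valuation K (x : K)) hc
  simp only [Rat.cast_mul _ (ℓ * bernoulli (ℓ - 1)), Rat.cast_mul _ (ℓ : ℚ), map_mul, hB,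
    mul_one, Rat.cast_intCast, Rat.cast_natCast] at h
  rw [h, mul_comm]
  exact mul_lt_one_of_lt_of_le (valuation_natCast_lt_one hv) (hint _)

/-- The Hasse invariant: a polynomial of weight `ℓ - 1` over the residue field with `q`-expansion
`1`, the reduction of `E_{ℓ-1}`. -/
theorem exists_hasse (ι : K →+* ℂ) (hℓ5 : 5 ≤ ℓ) : ∃ A : MvPolynomial (Fin 2) (ResField v),
    A.IsWeightedHomogeneous wt (ℓ - 1) ∧ qExp (ResField v) A = 1 := by
  obtain ⟨u, hu⟩ := exists_mul_1728_eq_one hℓ hv hℓ5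
  have hc := valuation_eisenstein_coeff_lt_one hℓ hv hℓ5
  set c : Ov v := ⟨_, hc.le⟩
  set j : Ov v →+* ℂ := ι.comp (Ov v).subtype
  have hj : Injective j := ι.injective.comp Subtype.val_injective
  set F : (Ov v)⟦X⟧ := PowerSeries.mk fun n ↦ if n = 0 then 1 else c * (σ (ℓ - 1 - 1) n : ℕ) with hF
  have hk : 3 ≤ ℓ - 1 := by omega
  have hev : Even (ℓ - 1) := by
    obtain ⟨m, hm⟩ := hℓ.odd_of_ne_two (by omega)
    exact ⟨m, by omega⟩
  obtain ⟨p, hp, hpF⟩ := exists_polynomial_of_modularForm hj hu (ℓ - 1) (ModularForm.E hk) F (by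
    convert! hasQExp_modularForm (ModularForm.E hk)
    ext n
    rw [EisensteinSeries.E_qExpansion_coeff hk hev]
    by_cases hn : n = 0
    · simp [hF, hn]
    · simp [hF, hn, j, c, map_ofNat ι])
  refine ⟨p.map (IsLocalRing.residue (Ov v)), isWeightedHomogeneous_map _ hp, ?_⟩
  rw [← map_qExp, hpF]
  ext n
  rw [PowerSeries.coeff_map, hF, PowerSeries.coeff_mk, PowerSeries.coeff_one]
  split_ifs
  · simp
  · rw [map_mul, (residue_eq_zero_iff v c).2 hc, zero_mul]

end Integers

end EtaForms

/-! ### Multiplication by powers of eta -/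

namespace EtaForms

open UpperHalfPlane Function ModularForm Filter

section Eta

theorem HasQExp.isZeroAtImInfty {h : ℝ} (hh : 0 < h) {f : ℍ → ℂ} {F : ℂ⟦X⟧} (hf : HasQExp h f F)
    (h0 : PowerSeries.constantCoeff F = 0) : IsZeroAtImInfty f := by
  obtain ⟨G, rfl⟩ := PowerSeries.X_dvd_iff.2 h0
  have hG : HasQExp h (fun τ : ℍ ↦ f τ / Periodic.qParam h τ) G := fun τ ↦ by
    have hq : Periodic.qParam h τ ≠ 0 := Periodic.qParam_ne_zero _
    have := (hasSum_nat_add_iff' 1).2 (hf τ)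
    simp only [PowerSeries.coeff_succ_X_mul, Finset.range_one, Finset.sum_singleton,
      PowerSeries.coeff_zero_X_mul, zero_mul, sub_zero] at this
    convert! this.div_const (Periodic.qParam h τ) using 2 with n
    field_simp
    ring
  have hq : IsZeroAtImInfty fun τ : ℍ ↦ Periodic.qParam h τ := qParam_tendsto_atImInfty hh
  have hb : IsBoundedAtImInfty fun τ : ℍ ↦ f τ / Periodic.qParam h τ :=
    isBoundedAtImInfty_of_hasSum_qExpansion hh hG
  have := hq.mul_boundedAtFilter hb
  refine this.congr fun τ ↦ ?_
  simp [mul_div_cancel₀ _ (Periodic.qParam_ne_zero (h := h) (τ : ℂ))]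

theorem mdifferentiable_eta : MDiff (fun z : ℍ ↦ eta (z : ℂ)) := by
  rw [UpperHalfPlane.mdifferentiable_iff]
  refine .congr (fun z hz ↦
    (differentiableAt_eta_of_mem_upperHalfPlaneSet hz).differentiableWithinAt) fun z hz ↦ ?_
  simp [ofComplex_apply_of_im_pos hz]

theorem etaMultiplier_pow_24 (γ : SL(2, ℤ)) : etaMultiplier γ ^ 24 = 1 :=
  eta_ratio_pow γ UpperHalfPlane.I

theorem etaMultiplier_pow_eq {m n : ℕ} (h : m ≡ n [MOD 24]) (γ : SL(2, ℤ)) :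
    etaMultiplier γ ^ m = etaMultiplier γ ^ n := by
  rw [← Nat.mod_add_div m 24, ← Nat.mod_add_div n 24, h, pow_add, pow_add, pow_mul, pow_mul,
    etaMultiplier_pow_24, one_pow, one_pow]

theorem autFactor_sqrt_pow (γ : SL(2, ℤ)) (z : ℍ) (n : ℕ) :
    (autFactor γ z ^ (1 / 2 : ℂ)) ^ n = autFactor γ z ^ ((n : ℂ) / 2) := by
  rw [← Complex.cpow_nat_mul]
  ring_nf

/-- Multiplying by a suitable power of `η` turns a form with `η`-multiplier into a form on
`SL₂(ℤ)` of integral weight. -/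
theorem exists_modularForm_mul_eta {k : ℝ} {r n W : ℕ} {g : ℍ → ℂ} {G : ℂ⟦X⟧}
    (hg : IsCuspForm k (fun γ ↦ etaMultiplier γ ^ r) g) (hG : HasQExp 24 g G)
    (hW : (W : ℝ) = k + n / 2) (hrn : 24 ∣ r + n) :
    ∃ M : ModularForm 𝒮ℒ (W : ℤ), HasQExp 24 M (G * etaSeries.map (Int.castRingHom ℂ) ^ n) := by
  have hq := hG.mul (hasQExp_eta.pow n)
  have hinv : ∀ γ : SL(2, ℤ), (g * (fun z : ℍ ↦ eta (z : ℂ)) ^ n) ∣[(W : ℤ)] γ =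
      g * (fun z : ℍ ↦ eta (z : ℂ)) ^ n := fun γ ↦ by
    funext z
    have ht := congrFun (hg.transform γ) z
    have hJ := autFactor_ne_zero γ z
    simp only [slash, Pi.smul_apply, smul_eq_mul] at ht
    have ht' : g (γ • z) = etaMultiplier γ ^ r * autFactor γ z ^ (k : ℂ) * g z := by
      rw [mul_right_comm, ← ht, Complex.cpow_neg]
      field_simp [Complex.cpow_ne_zero_iff_of_exponent_ne_zero, hJ]
    have hν : etaMultiplier γ ^ r * etaMultiplier γ ^ n = 1 := by
      rw [← pow_add, etaMultiplier_pow_eq (Nat.modEq_zero_iff_dvd.2 hrn), pow_zero]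
    have hJW : autFactor γ z ^ (k : ℂ) * autFactor γ z ^ ((n : ℂ) / 2) = autFactor γ z ^ W := by
      rw [← Complex.cpow_add _ _ hJ, ← Complex.cpow_natCast]
      congr 1
      have := congrArg ((↑) : ℝ → ℂ) hW
      push_cast at this
      exact this.symm
    rw [SL_slash_apply, ← autFactor_eq_denom, zpow_neg, zpow_natCast]
    simp only [Pi.mul_apply, Pi.pow_apply]
    rw [ht', eta_smul_eq, mul_pow, mul_pow, autFactor_sqrt_pow]
    rw [mul_inv_eq_iff_eq_mul₀ (pow_ne_zero _ hJ), ← hJW]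
    linear_combination (autFactor γ z ^ (k : ℂ) * autFactor γ z ^ ((n : ℂ) / 2) * g z *
      eta (z : ℂ) ^ n) * hν
  obtain ⟨M, hM⟩ := exists_modularForm (hg.holo.mul (mdifferentiable_eta.pow n)) hinv
    (by norm_num) hq
  exact ⟨M, hM ▸ hq⟩

/-- The product of a positive power of `η` and a modular form is a cusp form with multiplier. -/
theorem isCuspForm_eta_mul {k : ℝ} {r s n : ℕ} (M : ModularForm 𝒮ℒ (n : ℤ)) {F : ℂ⟦X⟧}
    (hF : HasQExp 24 M F) (hs : 0 < s) (hk : k = s / 2 + n) (hrs : r ≡ s [MOD 24]) :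
    ∃ f : ℍ → ℂ, IsCuspForm k (fun γ ↦ etaMultiplier γ ^ r) f ∧
      HasQExp 24 f (etaSeries.map (Int.castRingHom ℂ) ^ s * F) := by
  have hq := (hasQExp_eta.pow s).mul hF
  refine ⟨_, ⟨(mdifferentiable_eta.pow s).mul (show MDiff (⇑M) from M.holo'), fun γ ↦ ?_, ?_⟩, hq⟩
  · funext z
    have hJ := autFactor_ne_zero γ z
    have hM := congrFun (modularForm_slash M γ) z
    rw [SL_slash_apply, ← autFactor_eq_denom, zpow_neg, zpow_natCast,
      mul_inv_eq_iff_eq_mul₀ (pow_ne_zero _ hJ)] at hM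
    have hJk : autFactor γ z ^ (-(k : ℂ)) *
        (autFactor γ z ^ ((s : ℂ) / 2) * autFactor γ z ^ n) = 1 := by
      rw [← Complex.cpow_natCast _ n, ← Complex.cpow_add _ _ hJ, ← Complex.cpow_add _ _ hJ, hk]
      simp
    simp only [slash, Pi.smul_apply, smul_eq_mul, Pi.mul_apply, Pi.pow_apply]
    rw [hM, eta_smul_eq, mul_pow, mul_pow, autFactor_sqrt_pow, etaMultiplier_pow_eq hrs]
    linear_combination (etaMultiplier γ ^ s * eta (z : ℂ) ^ s * M z) * hJk
  · refine hq.isZeroAtImInfty (by norm_num) ?_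
    simp [etaSeries, hs.ne']

end Eta

end EtaForms

/-! ### Descent along `q ↦ q^ℓ` -/

namespace EtaForms

open Function IsDedekindDomain

section Frobenius

variable {k : Type*} [Field k] {ℓ : ℕ} [CharP k ℓ]

theorem expand_injective {R : Type*} [CommRing R] {p : ℕ} (hp : p ≠ 0) :
    Injective (PowerSeries.expand (R := R) p hp) := fun F G h ↦ by
  ext n
  rw [← PowerSeries.coeff_expand_mul p hp F, h, PowerSeries.coeff_expand_mul]

variable [Fact ℓ.Prime]

/-- In characteristic `ℓ`, raising to the power `ℓ` substitutes `X ^ ℓ` and twists by Frobenius. -/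
theorem pow_eq_expand_map_frobenius (Y : k⟦X⟧) : Y ^ ℓ =
    PowerSeries.expand ℓ (NeZero.ne ℓ) (Y.map (frobenius k ℓ)) := by
  rw [← PowerSeries.map_expand]
  exact (MvPowerSeries.map_frobenius_expand ℓ (NeZero.ne ℓ)).symm

theorem map_frobenius_map_intCast (F : ℤ⟦X⟧) :
    (F.map (Int.castRingHom k)).map (frobenius k ℓ) = F.map (Int.castRingHom k) := by
  rw [← RingHom.comp_apply, ← PowerSeries.map_comp,
    RingHom.ext_int ((frobenius k ℓ).comp (Int.castRingHom k)) (Int.castRingHom k)]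

/-- `Δ = η^24`, as series in `q^{1/24}`. -/
theorem expand_qExp_disc : PowerSeries.expand 24 (by norm_num) (qExp k (disc k)) =
    1728 * etaSeries.map (Int.castRingHom k) ^ 24 := by
  rw [qExp_disc, map_mul, map_mul, map_pow, PowerSeries.expand_X, etaSeries, map_mul,
    PowerSeries.map_X, PowerSeries.map_expand, map_pentagonalSeries, mul_pow, map_ofNat]

theorem map_etaSeries_ne_zero : etaSeries.map (Int.castRingHom k) ≠ 0 := by
  intro h
  have h1 := congrArg (PowerSeries.coeff 1) h
  rw [PowerSeries.coeff_map, etaSeries, show 1 = 0 + 1 from rfl, PowerSeries.coeff_succ_X_mul,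
    PowerSeries.coeff_zero_eq_constantCoeff_apply, PowerSeries.constantCoeff_expand,
    constantCoeff_pentagonalSeries] at h1
  simp at h1

/-- If the level one form `P` mod `ℓ` is `U(q^ℓ) η^{ℓt}`, then `U` is `η^{24-t}` times a form. -/
theorem exists_eta_pow_mul_qExp (hℓ5 : 5 ≤ ℓ) (hk : Surjective (fun x : k ↦ x ^ ℓ))
    {A : MvPolynomial (Fin 2) k} (hA : A.IsWeightedHomogeneous wt (ℓ - 1)) (hA1 : qExp k A = 1)
    {P : MvPolynomial (Fin 2) k} {W : ℕ} (hP : P.IsWeightedHomogeneous wt W) (hP0 : P ≠ 0)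
    {U : k⟦X⟧} {t : ℕ} (ht : 0 < t) (ht' : t ≤ 24)
    (hPU : PowerSeries.expand 24 (by norm_num) (qExp k P) =
      PowerSeries.expand ℓ (NeZero.ne ℓ) U * etaSeries.map (Int.castRingHom k) ^ (ℓ * t)) :
    ∃ (w : ℕ) (h : MvPolynomial (Fin 2) k), h.IsWeightedHomogeneous wt w ∧ ℓ * (w + 12) ≤ W ∧
      U = etaSeries.map (Int.castRingHom k) ^ (24 - t) *
        PowerSeries.expand 24 (by norm_num) (qExp k h) := by
  have hℓ : ℓ.Prime := Fact.out
  set E := etaSeries.map (Int.castRingHom k) with hE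
  have hE0 : PowerSeries.constantCoeff E = 0 := by
    rw [hE, constantCoeff_map, etaSeries]
    simp
  have hEℓ : E ^ ℓ = PowerSeries.expand ℓ (NeZero.ne ℓ) E := by
    rw [pow_eq_expand_map_frobenius, hE, map_frobenius_map_intCast]
  have hPU' : PowerSeries.expand 24 (by norm_num) (qExp k P) =
      PowerSeries.expand ℓ (NeZero.ne ℓ) (U * E ^ t) := by
    rw [hPU, pow_mul, hEℓ, map_mul, map_pow]
  have hθ : theta k (qExp k P) = 0 := by
    ext n
    rw [coeff_theta, map_zero]
    by_cases hn : ℓ ∣ n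
    · rw [(CharP.cast_eq_zero_iff k ℓ n).2 hn, zero_mul]
    · rw [← PowerSeries.coeff_expand_mul 24 (by norm_num) (qExp k P), hPU',
        PowerSeries.coeff_expand_of_not_dvd, mul_zero]
      intro h
      rcases hℓ.dvd_mul.1 h with h | h
      · have h' : ℓ ∣ 2 ^ 3 * 3 := h
        rcases hℓ.dvd_mul.1 h' with h | h
        · have := Nat.le_of_dvd two_pos (hℓ.dvd_of_dvd_pow h)
          omega
        · have := Nat.le_of_dvd three_pos h
          omega
      · exact hn h
  obtain ⟨w, H, hH, hw, hHP⟩ := exists_pow_of_theta_eq_zero hℓ hℓ5 hk hA hA1 hP hP0 hθ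
  -- the root vanishes at the cusp, so that it is a multiple of the discriminant
  have hH0 : PowerSeries.constantCoeff (qExp k H) = 0 := by
    refine pow_eq_zero_iff hℓ.ne_zero |>.1 ?_
    rw [← map_pow, hHP, ← PowerSeries.constantCoeff_expand 24 (by norm_num), hPU']
    rw [PowerSeries.constantCoeff_expand, map_mul, map_pow, hE0, zero_pow ht.ne', mul_zero]
  have hHne : H ≠ 0 := by
    rintro rfl
    refine hP0 (eq_zero_of_qExp_eq_zero (ne_zero_1728_of_charP hℓ5) hP ?_)
    rw [← hHP, map_zero, zero_pow hℓ.ne_zero]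
  obtain ⟨c, n, rfl, hc, rfl⟩ := IsWeightedHomogeneous.exists_quotient isWeightedHomogeneous_disc
    hH hHne (disc_dvd_of_constantCoeff_eq_zero hH hH0)
  refine ⟨n, (MvPolynomial.C 1728 * c).map (frobenius k ℓ),
    isWeightedHomogeneous_map _ (hc.C_mul _), by rwa [add_comm n], ?_⟩
  have hY : PowerSeries.expand 24 (by norm_num) (qExp k (disc k * c)) =
      E ^ 24 * PowerSeries.expand 24 (by norm_num) (qExp k (MvPolynomial.C 1728 * c)) := by
    rw [map_mul (qExp k) (disc k), map_mul (qExp k) (MvPolynomial.C _), map_mul, map_mul,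
      expand_qExp_disc, ← MvPolynomial.algebraMap_eq, AlgHom.commutes, AlgHom.commutes, map_ofNat]
    ring
  have hUE : U * E ^ t = E ^ 24 * PowerSeries.expand 24 (by norm_num)
      (qExp k ((MvPolynomial.C 1728 * c).map (frobenius k ℓ))) := by
    apply expand_injective (NeZero.ne ℓ)
    rw [← hPU', ← hHP, map_pow, hY, pow_eq_expand_map_frobenius, map_mul (PowerSeries.map _),
      map_pow, hE, map_frobenius_map_intCast, PowerSeries.map_expand, map_qExp]
  refine mul_right_cancel₀ (pow_ne_zero t (map_etaSeries_ne_zero (k := k))) ?_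
  rw [← hE, hUE, mul_right_comm, ← pow_add, Nat.sub_add_cancel ht']

end Frobenius

section Integers

variable {K : Type*} [Field K] [NumberField K] {v : HeightOneSpectrum (𝓞 K)}

theorem exists_map_eq_of_vIntegral {G : K⟦X⟧} (hG : VIntegral v G) :
    ∃ G' : (Ov v)⟦X⟧, G'.map (Ov v).subtype = G :=
  ⟨PowerSeries.mk fun n ↦ ⟨PowerSeries.coeff n G, hG n⟩, by ext; simp⟩

theorem coeff_map_residue_eq_zero_iff (G : (Ov v)⟦X⟧) (n : ℕ) :
    PowerSeries.coeff n (G.map (IsLocalRing.residue (Ov v))) = 0 ↔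
      v.valuation K (PowerSeries.coeff n (G.map (Ov v).subtype)) < 1 := by
  rw [PowerSeries.coeff_map, residue_eq_zero_iff, PowerSeries.coeff_map]
  rfl

theorem exists_lift_isWeightedHomogeneous {w : ℕ} {h : MvPolynomial (Fin 2) (ResField v)}
    (hh : h.IsWeightedHomogeneous wt w) : ∃ p : MvPolynomial (Fin 2) (Ov v),
      p.IsWeightedHomogeneous wt w ∧ p.map (IsLocalRing.residue (Ov v)) = h := by
  choose lift hlift using IsLocalRing.residue_surjective (R := Ov v)
  refine ⟨∑ d ∈ h.support, MvPolynomial.monomial d (lift (h.coeff d)),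
    MvPolynomial.IsWeightedHomogeneous.sum _ _ _ fun d hd ↦
      MvPolynomial.isWeightedHomogeneous_monomial _ _ _
        (hh (MvPolynomial.mem_support_iff.1 hd)), ?_⟩
  conv_rhs => rw [h.as_sum]
  simp [MvPolynomial.map_monomial, hlift]

theorem map_map_intCast {R S : Type*} [CommRing R] [CommRing S] (j : R →+* S) (F : ℤ⟦X⟧) :
    (F.map (Int.castRingHom R)).map j = F.map (Int.castRingHom S) := by
  rw [← RingHom.comp_apply, ← PowerSeries.map_comp,
    RingHom.ext_int (j.comp (Int.castRingHom R)) (Int.castRingHom S)]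

/-- The level one form `g η^n` as a polynomial in `E₄`, `E₆` over the coefficient ring of `g`. -/
theorem exists_polynomial_mul_eta {R : Type*} [CommRing R] {j : R →+* ℂ} (hj : Injective j)
    {u : R} (hu : u * 1728 = 1) {k : ℝ} {r n W : ℕ} {g : ℍ → ℂ} {G : R⟦X⟧}
    (hg : IsCuspForm k (fun γ ↦ etaMultiplier γ ^ r) g) (hG : HasQExp 24 g (G.map j))
    (hW : (W : ℝ) = k + n / 2) (hrn : 24 ∣ r + n) :
    ∃ P : MvPolynomial (Fin 2) R, P.IsWeightedHomogeneous wt W ∧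
      PowerSeries.expand 24 (by norm_num) (qExp R P) =
        G * etaSeries.map (Int.castRingHom R) ^ n := by
  obtain ⟨M, hM⟩ := exists_modularForm_mul_eta hg hG hW hrn
  have hM1 := hasQExp_modularForm M
  have hexp := hM1.expand.unique (by norm_num) hM
  set G1 := G * etaSeries.map (Int.castRingHom R) ^ n with hG1
  have hG1j : G1.map j = G.map j * etaSeries.map (Int.castRingHom ℂ) ^ n := by
    rw [hG1, map_mul, map_pow, map_map_intCast]
  rw [← hG1j] at hexp
  -- the expansion of a form of level one in `q^{1/24}` involves only integral powers of `q`
  set Q : R⟦X⟧ := PowerSeries.mk fun m ↦ PowerSeries.coeff (24 * m) G1 with hQ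
  have hQj : UpperHalfPlane.qExpansion 1 M = Q.map j := by
    ext m
    rw [PowerSeries.coeff_map, hQ, PowerSeries.coeff_mk, ← PowerSeries.coeff_map, ← hexp,
      PowerSeries.coeff_expand_mul]
  obtain ⟨P, hP, hPQ⟩ := exists_polynomial_of_modularForm hj hu W M Q (hQj ▸ hM1)
  refine ⟨P, hP, ?_⟩
  have hinj : Injective (PowerSeries.map j) := PowerSeries.map_injective j hj
  apply hinj
  rw [hPQ, PowerSeries.map_expand, ← hQj, hexp]

end Integers

/-- The exponent `t` serves both forms, as `ℓ² ≡ 1` modulo `24`. -/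
theorem exists_eta_exponent {ℓ r : ℕ} (hℓ : ℓ.Prime) (hℓ5 : 5 ≤ ℓ) (hr : r.Coprime 6) :
    ∃ t, 0 < t ∧ t < 24 ∧ Odd t ∧ 24 ∣ r * ℓ + t ∧ 24 ∣ r + ℓ * t := by
  have h2 : ℓ % 2 = 1 := Nat.odd_iff.1 (hℓ.odd_of_ne_two (by omega))
  have h3 : ℓ % 3 ≠ 0 := fun h ↦ by
    have := (Nat.prime_dvd_prime_iff_eq Nat.prime_three hℓ).1 (Nat.dvd_of_mod_eq_zero h)
    omega
  have hr2 : r % 2 = 1 := Nat.odd_iff.1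
    ((Nat.coprime_two_right).1 (hr.coprime_dvd_right (by norm_num)))
  have hodd : r * ℓ % 2 = 1 := by rw [Nat.mul_mod, h2, hr2]
  obtain ⟨t, ht0, ht⟩ : ∃ t, 0 < t ∧ t = 24 - r * ℓ % 24 :=
    ⟨_, by have := Nat.mod_lt (r * ℓ) (show 0 < 24 by norm_num); omega, rfl⟩
  refine ⟨t, ht0, by omega, Nat.odd_iff.2 (by omega), by omega, ?_⟩
  have hsq : 24 ∣ ℓ * ℓ - 1 := by
    have h24 : ℓ * ℓ % 24 = 1 := by
      have h : ℓ % 24 < 24 := Nat.mod_lt _ (by norm_num)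
      have e2 : ℓ % 24 % 2 = 1 := by omega
      have e3 : ℓ % 24 % 3 ≠ 0 := by omega
      rw [Nat.mul_mod]
      generalize ℓ % 24 = x at *
      interval_cases x <;> simp_all
    omega
  obtain ⟨a, ha⟩ : 24 ∣ r * ℓ + t := by omega
  obtain ⟨b, hb⟩ := hsq
  have hb' : ℓ * ℓ = 24 * b + 1 := by
    have := Nat.mul_pos hℓ.pos hℓ.pos
    omega
  have h : r + ℓ * t + 24 * (r * b) = 24 * (ℓ * a) := by
    have := congrArg (ℓ * ·) ha
    linear_combination this - r * hb'
  exact (Nat.dvd_add_left (dvd_mul_right 24 (r * b))).1 (h ▸ dvd_mul_right 24 (ℓ * a))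

end EtaForms

open EtaForms
theorem lemma3p2 {K : Type*} [Field K] [NumberField K] [IsGalois ℚ K]
    (ι : K →+* ℂ) (ℓ : ℕ) (hℓ : ℓ.Prime) (hℓ5 : 5 ≤ ℓ)
    (v : IsDedekindDomain.HeightOneSpectrum (𝓞 K)) (hv : (ℓ : 𝓞 K) ∈ v.asIdeal)
    (lam r : ℕ) (hr : 0 < r) (hr6 : r.Coprime 6)
    (g : K⟦X⟧) (hg : g ∈ cuspSpace ι v ((lam : ℝ) + 1 / 2) r)
    (a : ℕ → K) (hga : CongrMod v g (opV ℓ (series a))) (hg0 : ¬ CongrMod v g 0) :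
    ∃ lam' : ℕ, (lam' : ℝ) + 1 / 2 ≤ 1 / (ℓ : ℝ) * ((lam : ℝ) + 1 / 2) ∧
      ∃ f ∈ cuspSpace ι v ((lam' : ℝ) + 1 / 2) (r * ℓ),
        CongrMod v f (opU ℓ g) ∧ CongrMod v f (series a) := by
  obtain ⟨hgint, g', hg', hgG⟩ := hg
  obtain ⟨G, rfl⟩ := exists_map_eq_of_vIntegral hgint
  rw [hasFourierExpansion_iff] at hgG
  have := charP_resField hℓ hv
  have : Fact ℓ.Prime := ⟨hℓ⟩
  set ρ := IsLocalRing.residue (Ov v)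
  set j : Ov v →+* ℂ := ι.comp (Ov v).subtype
  have hjinj : Function.Injective j := ι.injective.comp Subtype.val_injective
  have hmapj (F : (Ov v)⟦X⟧) : (F.map (Ov v).subtype).map ι = F.map j := by
    rw [← RingHom.comp_apply, ← PowerSeries.map_comp]
  rw [hmapj] at hgG
  obtain ⟨u, hu⟩ := exists_mul_1728_eq_one hℓ hv hℓ5
  obtain ⟨t, ht0, ht24, ⟨t', ht'⟩, hrt, hrℓt⟩ := exists_eta_exponent hℓ hℓ5 hr6
  obtain ⟨ℓ', hℓ'⟩ := hℓ.odd_of_ne_two (by omega)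
  obtain ⟨W, hW⟩ : ∃ W, 2 * W = 2 * lam + 1 + ℓ * t :=
    ⟨lam + 1 + ℓ' + t' + 2 * ℓ' * t', by rw [hℓ', ht']; ring⟩
  obtain ⟨P, hP, hPG⟩ := exists_polynomial_mul_eta hjinj hu (W := W) (n := ℓ * t) hg' hgG
    (by
      have : (2 * W : ℝ) = 2 * lam + 1 + ℓ * t := mod_cast hW
      push_cast
      linarith) hrℓt
  -- modulo `v` the form `g` is a series in `q^{ℓ/24}`
  set U := PowerSeries.mk fun n ↦ PowerSeries.coeff (ℓ * n) (G.map ρ) with hU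
  have hGU : G.map ρ = PowerSeries.expand ℓ hℓ.ne_zero U := by
    ext n
    by_cases hn : ℓ ∣ n
    · obtain ⟨m, rfl⟩ := hn
      rw [PowerSeries.coeff_expand_mul, hU, PowerSeries.coeff_mk]
    · rw [PowerSeries.coeff_expand_of_not_dvd _ _ _ hn, coeff_map_residue_eq_zero_iff]
      simpa [opV, hn] using hga n
  have hPbar : PowerSeries.expand 24 (by norm_num) (qExp (ResField v) (P.map ρ)) =
      PowerSeries.expand ℓ hℓ.ne_zero U *
        etaSeries.map (Int.castRingHom (ResField v)) ^ (ℓ * t) := by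
    rw [← map_qExp, ← PowerSeries.map_expand, hPG, map_mul, map_pow, map_map_intCast, hGU]
  have hP0 : P.map ρ ≠ 0 := by
    intro h0
    rw [h0, map_zero, map_zero, ← hGU, eq_comm, mul_eq_zero,
      or_iff_left (pow_ne_zero _ map_etaSeries_ne_zero)] at hPbar
    refine hg0 fun n ↦ ?_
    rw [map_zero, sub_zero, ← coeff_map_residue_eq_zero_iff, hPbar, map_zero]
  obtain ⟨A, hA, hA1⟩ := exists_hasse hℓ hv ι hℓ5
  obtain ⟨w, h, hh, hw, hUh⟩ := exists_eta_pow_mul_qExp hℓ5 (surjective_pow hℓ hv) hA hA1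
    (isWeightedHomogeneous_map ρ hP) hP0 ht0 ht24.le hPbar
  obtain ⟨p, hp, rfl⟩ := exists_lift_isWeightedHomogeneous hh
  obtain ⟨M, hM⟩ := exists_modularForm_of_polynomial j hp
  set F := etaSeries.map (Int.castRingHom (Ov v)) ^ (24 - t) *
    PowerSeries.expand 24 (by norm_num) (qExp (Ov v) p) with hF
  have hFU : F.map ρ = U := by
    rw [hUh, hF, map_mul, map_pow, map_map_intCast, PowerSeries.map_expand, map_qExp]
  -- as `t = 2 t' + 1` with `t' ≤ 11`, the weight `(24 - t) / 2 + w` is `(w + 11 - t') + 1 / 2`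
  obtain ⟨f, hf, hfF⟩ := isCuspForm_eta_mul (k := ((w + 11 - t' : ℕ) : ℝ) + 1 / 2) (r := r * ℓ)
    (s := 24 - t) M hM.expand (by omega) (by
      have : (w + 11 - t' : ℕ) + t' = w + 11 := by omega
      have h1 : ((w + 11 - t' : ℕ) : ℝ) + t' = w + 11 := mod_cast this
      have h2 : (t : ℝ) = 2 * t' + 1 := mod_cast ht'
      rw [Nat.cast_sub ht24.le, h2]
      push_cast
      linarith) (by
      rw [Nat.ModEq]
      omega)
  -- the two congruences, at a single coefficient
  have hcongr (n : ℕ) : v.valuation K (PowerSeries.coeff n (F.map (Ov v).subtype) -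
      PowerSeries.coeff (ℓ * n) (G.map (Ov v).subtype)) < 1 := by
    have h0 : PowerSeries.coeff n (F.map ρ) = PowerSeries.coeff (ℓ * n) (G.map ρ) := by
      rw [hFU, hU, PowerSeries.coeff_mk]
    rw [PowerSeries.coeff_map, PowerSeries.coeff_map, ← sub_eq_zero, ← map_sub,
      residue_eq_zero_iff] at h0
    simpa using h0
  refine ⟨w + 11 - t', ?_, F.map (Ov v).subtype, ⟨fun n ↦ ?_, f, hf, ?_⟩, fun n ↦ ?_, fun n ↦ ?_⟩
  · have hw' : (ℓ * (w + 12) : ℝ) ≤ W := mod_cast hw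
    have hW' : (2 * W : ℝ) = 2 * lam + 1 + ℓ * t := mod_cast hW
    have h1 : ((w + 11 - t' : ℕ) : ℝ) + t' = w + 11 := by
      have : (w + 11 - t' : ℕ) + t' = w + 11 := by omega
      exact_mod_cast this
    have h2 : (t : ℝ) = 2 * t' + 1 := mod_cast ht'
    have h3 : ((w + 11 - t' : ℕ) : ℝ) = w + 11 - t' := by linarith
    have hℓ0 : (0 : ℝ) < ℓ := mod_cast hℓ.pos
    rw [one_div_mul_eq_div, le_div_iff₀ hℓ0, h3]
    rw [h2] at hW'
    linarith
  · rw [PowerSeries.coeff_map]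
    exact (PowerSeries.coeff n F).2
  · rw [hasFourierExpansion_iff, hmapj, hF, map_mul, map_pow, map_map_intCast,
      PowerSeries.map_expand]
    exact hfF
  · rw [opU, PowerSeries.coeff_mk]
    exact hcongr n
  · have h1 := hga (ℓ * n)
    have h2 : PowerSeries.coeff (ℓ * n) (opV ℓ (series a)) = PowerSeries.coeff n (series a) := by
      rw [opV, PowerSeries.coeff_mk, if_pos (dvd_mul_right ℓ n),
        Nat.mul_div_cancel_left n hℓ.pos]
    rw [h2] at h1
    have := Valuation.map_add_lt _ (hcongr n) h1
    rwa [sub_add_sub_cancel] at this
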